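/- Let $\tau\in\mathbb{C}$ with $\operatorname{Im}\tau>0$, $\Lambda=\mathbb{Z}+\mathbb{Z}\tau$, and $T=\mathbb{C}/\Lambda$. Let $\wp$ be the Weierstrass function of $\Lambda$, with $\wp'^2=4\wp^3-g_2\wp-g_3$, and let $\eta=-\int_{\gamma_1}\wp$ be its quasi-period along the cycle $\gamma_1$ corresponding to the period $1$. A solution of the Main Problem on $T$ is a proper minimal (i.e. conformal harmonic) immersion $F:T\setminus\{0\}\to\mathbb{R}^4$ with total Gaussian curvature $-8\pi$ and one single end, that is: outside some ball the surface is contained in an annulus parametrized conformally by $\{|\zeta|>R\}$ on which, for some integer $N\ge1$ and in suitable orthonormal coordinates of $\mathbb{R}^4\simeq\mathbb{C}^2$, $F$ has the form $\zeta\mapsto(\zeta^N+o(|\zeta|^N),\,o(|\zeta|^N))$ as $\zeta\to\infty$. It is of type (II) if $F=(e+\bar f,\,g+\bar h)$ in $\mathbb{C}^2\simeq\mathbb{R}^4$ with $e,f,g,h$ holomorphic on $\mathbb{C}\setminus\Lambda$, where $e',f',g',h'$ are $\Lambda$-periodic and meromorphic, $e'f'+g'h'=0$, $e'$ has a pole of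 order $4$ at $0$, $g'$ and $h'$ have poles of order at most $3$ at $0$, and $f'=\wp+s$ for some constant $s\in\mathbb{C}$. The torus $T$ admits a type (II) solution of the Main Problem if there are complex numbers $a,b,c,d,s,t,u,v,w,y,z$ which satisfy $$\begin{cases} a+4tw=0\\ b+ty+uw=0\\ c+as+uy=0\\ d+cs+uz+vy-g_2tw=0\\ bs+vw+tz=0\\ ds+vz-g_3tw=0\end{cases}$$ $$\begin{cases} c-1+\dfrac{\operatorname{Im}\tau}{\pi}(\bar\eta-\bar s)=0\\[1ex] c\Big(1-\dfrac{\operatorname{Im}\tau}{\pi}\eta\Big)+\dfrac{\operatorname{Im}\tau}{\pi}\Big(a\dfrac{g_2}{12}+d\Big)-1=0\end{cases}$$ $$\begin{cases} u+\bar y\Big(\dfrac{\operatorname{Im}\tau}{\pi}\bar\eta-1\Big)-\dfrac{\operatorname{Im}\tau}{\pi}\bar z=0\\[1ex] u\Big(1-\dfrac{\operatorname{Im}\tau}{\pi}\eta\Big)+\dfrac{\operatorname{Im}\tau}{\pi}v-\bar y=0.\end{cases}$$ -/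

import Mathlib

open scoped Real InnerProductSpace Laplacian ComplexConjugate
open MeasureTheory

namespace MinimalTorus

/-- The period pair `(1, τ)`, for `τ` in the upper half-plane. -/
noncomputable def periods (τ : UpperHalfPlane) : PeriodPair where
  ω₁ := 1
  ω₂ := (τ : ℂ)
  indep := by
    rw [LinearIndependent.pair_iff]
    intro a b h
    have hi : b * (τ : ℂ).im = 0 := by simpa using congrArg Complex.im h
    have hb : b = 0 := (mul_eq_zero.mp hi).resolve_right τ.im_pos.ne'
    refine ⟨?_, hb⟩
    simpa [hb] using congrArg Complex.re h

/-- The quasi-period `η₁ = - ∫_{γ₁} ℘`, where the cycle `γ₁` of period `1` is represented by the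
segment from `τ / 2` to `τ / 2 + 1`, which avoids the poles of `℘`. -/
noncomputable def eta₁ (τ : UpperHalfPlane) : ℂ :=
  -∫ x in (0 : ℝ)..1, (periods τ).weierstrassP ((τ : ℂ) / 2 + (x : ℂ))

/-- Euclidean four-space. -/
abbrev R4 : Type := EuclideanSpace ℝ (Fin 4)

/-- The standard identification of `ℂ²` with `ℝ⁴`. -/
noncomputable def ofC2 (X Y : ℂ) : R4 := !₂[X.re, X.im, Y.re, Y.im]

/-- The torus `ℂ / (ℤ ω₁ + ℤ ω₂)`. -/
abbrev Torus (L : PeriodPair) : Type := ℂ ⧸ L.lattice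

/-- The projection from `ℂ` to the torus. -/
def proj (L : PeriodPair) (z : ℂ) : Torus L := Submodule.Quotient.mk z

/-- The half-open period parallelogram with its vertex `0` removed: a fundamental domain for the
torus minus the point `0`. -/
def puncturedCell (L : PeriodPair) : Set ℂ :=
  {z | z ≠ 0 ∧ ∃ x ∈ Set.Ico (0 : ℝ) 1, ∃ y ∈ Set.Ico (0 : ℝ) 1, z = x * L.ω₁ + y * L.ω₂}

/-- The conformal factor `ρ` of the metric `ρ (dx² + dy²)` which a conformal map `u` induces. -/
noncomputable def conformalFactor (u : ℂ → R4) (z : ℂ) : ℝ := ‖fderiv ℝ u z 1‖ ^ 2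

/-- The Gaussian curvature `- Δ (log ρ) / (2 ρ)` of the induced metric `ρ (dx² + dy²)` of a
conformal immersion `u`. -/
noncomputable def gaussCurvature (u : ℂ → R4) (z : ℂ) : ℝ :=
  -(Δ (fun w => Real.log (conformalFactor u w))) z / (2 * conformalFactor u z)

/-- A map `F`, considered only on the torus minus the point `0`, is a conformal harmonic (that is,
minimal) immersion. `ConformalAt` says that the differential is a nonzero multiple of a linear
isometry, so it contains the immersion property. -/
structure IsMinimalImmersion (L : PeriodPair) (F : Torus L → R4) : Prop where
  harmonic : InnerProductSpace.HarmonicOnNhd (fun z => F (proj L z)) (L.lattice : Set ℂ)ᶜ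
  conformal : ∀ z ∉ L.lattice, ConformalAt (fun z => F (proj L z)) z

/-- The surface given by `F` on the torus minus `0` has total Gaussian curvature `κ`: the
integral of `K` against the area element `ρ dx dy` converges absolutely and equals `κ`. -/
def HasTotalCurvature (L : PeriodPair) (F : Torus L → R4) (κ : ℝ) : Prop :=
  IntegrableOn (fun z => gaussCurvature (fun z => F (proj L z)) z *
      conformalFactor (fun z => F (proj L z)) z) (puncturedCell L) volume ∧
    ∫ z in puncturedCell L, gaussCurvature (fun z => F (proj L z)) z *
      conformalFactor (fun z => F (proj L z)) z = κ

/-- Outside some ball of radius `r` the surface consists of one end: an annulus in the torus minus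
`0`, parametrized conformally by `{|z| > R}`, on which `F`, in suitable orthonormal coordinates of
`ℝ⁴ = ℂ²`, is `z ↦ (z ^ N + o(|z| ^ N), o(|z| ^ N))` as `z → ∞`. -/
def HasSingleEnd (L : PeriodPair) (F : Torus L → R4) : Prop :=
  ∃ (N : ℕ) (R r : ℝ) (φ : ℂ → ℂ) (A : R4 ≃ₗᵢ[ℝ] R4), 1 ≤ N ∧ 0 < R ∧
    DifferentiableOn ℂ φ {z | R < ‖z‖} ∧
    (∀ z, R < ‖z‖ → φ z ∉ L.lattice) ∧
    Set.InjOn (fun z => proj L (φ z)) {z | R < ‖z‖} ∧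
    (∀ p : Torus L, p ≠ 0 → r < ‖F p‖ → ∃ z, R < ‖z‖ ∧ proj L (φ z) = p) ∧
    (fun z => A (F (proj L (φ z))) - ofC2 (z ^ N) 0) =o[Bornology.cobounded ℂ] fun z => z ^ N

/-- Solution of the Main Problem on the torus `ℂ / L`: a proper minimal immersion into `ℝ⁴` of the
torus minus the point `0`, with one single end and total curvature `-8π`. The value of `F` at the
point `0` plays no role. -/
structure IsSolution (L : PeriodPair) (F : Torus L → R4) : Prop where
  minimal : IsMinimalImmersion L F
  proper : IsProperMap (({0}ᶜ : Set (Torus L)).domRestrict F)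
  single_end : HasSingleEnd L F
  curvature : HasTotalCurvature L F (-(8 * π))

/-- `k` is (off the lattice) an elliptic function, holomorphic off the lattice. -/
structure IsElliptic (L : PeriodPair) (k : ℂ → ℂ) : Prop where
  meromorphic : Meromorphic k
  holomorphic : DifferentiableOn ℂ k (L.lattice : Set ℂ)ᶜ
  periodic : ∀ l ∈ L.lattice, ∀ z ∉ L.lattice, k (z + l) = k z

/-- Type (II): `F = (e + conj f, g + conj h)` with `e, f, g, h` holomorphic off the lattice,
`e', f', g', h'` elliptic, `e' f' + g' h' = 0`, where `e'` has a pole of order `4` at `0`,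
`g'` and `h'` have poles of order at most `3` there, and `f' = ℘ + s` for a constant `s`. -/
def IsTypeII (L : PeriodPair) (F : Torus L → R4) : Prop :=
  ∃ (e f g h : ℂ → ℂ) (s : ℂ),
    (DifferentiableOn ℂ e (L.lattice : Set ℂ)ᶜ ∧ DifferentiableOn ℂ f (L.lattice : Set ℂ)ᶜ ∧
      DifferentiableOn ℂ g (L.lattice : Set ℂ)ᶜ ∧ DifferentiableOn ℂ h (L.lattice : Set ℂ)ᶜ) ∧
    (∀ z ∉ L.lattice, F (proj L z) = ofC2 (e z + conj (f z)) (g z + conj (h z))) ∧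
    (IsElliptic L (deriv e) ∧ IsElliptic L (deriv f) ∧
      IsElliptic L (deriv g) ∧ IsElliptic L (deriv h)) ∧
    (∀ z ∉ L.lattice, deriv e z * deriv f z + deriv g z * deriv h z = 0) ∧
    meromorphicOrderAt (deriv e) 0 = ((-4 : ℤ) : WithTop ℤ) ∧
    ((-3 : ℤ) : WithTop ℤ) ≤ meromorphicOrderAt (deriv g) 0 ∧
    ((-3 : ℤ) : WithTop ℤ) ≤ meromorphicOrderAt (deriv h) 0 ∧
    (∀ z ∉ L.lattice, deriv f z = L.weierstrassP z + s)

/-- The torus `ℂ / L` admits a type (II) solution of the Main Problem. -/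
def AdmitsTypeIISolution (L : PeriodPair) : Prop :=
  ∃ F : Torus L → R4, IsSolution L F ∧ IsTypeII L F

end MinimalTorus

/-! ### The lattice complement and the regular parts of `℘` and `℘'`. -/

namespace PeriodPair

open Filter Topology

variable (L : PeriodPair)

/-! Put `e' = a℘² + b℘' + c℘ + d`, `f' = ℘ + s`, `g' = t℘' + u℘ + v`, `h' = w℘' + y℘ + x`, where `x`
stands for the unknown `z` of the system. The six algebraic equations say that, as a polynomial in
`P = ℘` and `Q = ℘'`, `e'f' + g'h'` equals `tw(Q² - 4P³ + g₂P + g₃)`, so it vanishes on the cubic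
(`isotropic`). Since `℘² = ℘''/6 + g₂/12`, all primitives are explicit in `℘'`, `℘`, `ζ` and `z`. By
the Legendre relation the remaining four equations say exactly that `e + conj f` and `g + conj h`
have no periods (`period_eq_zero`), so `F` descends to the torus.

Two nondegeneracy facts are hidden in the system. If `a = 0`, it forces `|u|² + 1 = 0` or `|y|² + 1
= 0` (`leading_coeff_ne_zero`); hence `e'` has a pole of order exactly 4, and `e ~ -(a/3) z⁻³`
dominates at the puncture, which gives properness and a single end with `N = 3`. A common zero of
the four derivatives would be a singular point of the smooth cubic (`no_common_zero`), so `F` is an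
immersion.

By isotropy the conformal factor is `ρ = ∑ |kᵢ|²`, with `k` the four derivatives, and `Kρ = -½ Δ log
ρ`. The function `∂_z log ρ + 4ζ` extends smoothly over the lattice points and has the quasi-periods
of `4ζ`. Green's formula on the period cell and Legendre then give `∫ Δ log ρ = 16π`
(`integral_laplacian_log` with `N = 4`), that is, total curvature `-8π`. -/

theorem isPreconnected_compl_lattice : IsPreconnected (L.lattice : Set ℂ)ᶜ :=
  (Set.Countable.isConnected_compl_of_one_lt_rank (by simp)
    (countable_of_Lindelof_of_discrete (X := L.lattice))).isPreconnected

theorem isOpen_compl_lattice : IsOpen (L.lattice : Set ℂ)ᶜ :=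
  L.isClosed_lattice.isOpen_compl

variable {L}

theorem add_notMem_lattice {z l : ℂ} (hz : z ∉ L.lattice) (hl : l ∈ L.lattice) :
    z + l ∉ L.lattice := fun h => hz ((L.lattice.add_mem_iff_left hl).mp h)

variable (L)

theorem weierstrassPExcept_zero_eq (z : ℂ) :
    L.weierstrassP z = L.weierstrassPExcept 0 z + 1 / z ^ 2 := by
  simpa using (L.weierstrassPExcept_add 0 z).symm

theorem derivWeierstrassPExcept_zero_eq (z : ℂ) :
    L.derivWeierstrassP z = L.derivWeierstrassPExcept 0 z - 2 / z ^ 3 := by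
  simpa using (L.derivWeierstrassPExcept_sub 0 z).symm

/-! ### The zeta function and its quasi-periods. -/

/-- The Weierstrass zeta function without its pole at the origin. -/
noncomputable def zetaRegular (z : ℂ) : ℂ :=
  ∑' l : L.lattice, if l.1 = 0 then 0 else (1 / (z - l) + 1 / l + z / l ^ 2)

/-- The Weierstrass zeta function. -/
noncomputable def weierstrassZeta (z : ℂ) : ℂ := 1 / z + L.zetaRegular z

/-- The correction terms collapse the summand to `s² / (l² (s - l))`, which decays cubically in `l`;
this is what makes the series summable over a planar lattice. -/
theorem norm_zeta_summand_le {r : ℝ} (hr : 0 < r) {s : ℂ} (hs : ‖s‖ < r) {l : ℂ}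
    (h : 2 * r ≤ ‖l‖) :
    ‖1 / (s - l) + 1 / l + s / l ^ 2‖ ≤ 2 * r ^ 2 * ‖l‖ ^ (-3 : ℝ) := by
  have hl : 0 < ‖l‖ := by linarith
  have hl0 : l ≠ 0 := norm_pos_iff.mp hl
  have hsl : s - l ≠ 0 := by
    rw [sub_ne_zero]; rintro rfl; linarith
  have e : 1 / (s - l) + 1 / l + s / l ^ 2 = s ^ 2 / (l ^ 2 * (s - l)) := by
    field_simp; ring
  have h2 : ‖l‖ / 2 ≤ ‖s - l‖ := by
    rw [norm_sub_rev]; exact .trans (by linarith) (norm_sub_norm_le l s)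
  rw [e, norm_div, norm_mul, norm_pow, norm_pow]
  calc ‖s‖ ^ 2 / (‖l‖ ^ 2 * ‖s - l‖) ≤ r ^ 2 / (‖l‖ ^ 2 * (‖l‖ / 2)) := by gcongr
    _ = 2 * r ^ 2 / ‖l‖ ^ 3 := by field
    _ = _ := by norm_cast

theorem hasSumLocallyUniformly_zetaRegular :
    HasSumLocallyUniformly
      (fun (l : L.lattice) (z : ℂ) ↦ if l.1 = 0 then 0 else (1 / (z - l) + 1 / l + z / l ^ 2))
      L.zetaRegular := by
  refine L.hasSumLocallyUniformly_aux (u := fun r l => 2 * r ^ 2 * ‖l‖ ^ (-3 : ℝ)) _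
    (fun _ _ ↦ (ZLattice.summable_norm_rpow _ _ (by simp; norm_num)).mul_left _) fun r hr ↦
    Filter.eventually_atTop.mpr ⟨2 * r, ?_⟩
  rintro _ h s hs l rfl
  split_ifs
  · simpa using! show 0 ≤ 2 * r ^ 2 * (‖(l : ℂ)‖ ^ 3)⁻¹ by positivity
  · exact norm_zeta_summand_le hr hs h

theorem differentiableOn_zetaRegular :
    DifferentiableOn ℂ L.zetaRegular (L.lattice \ {0})ᶜ := by
  refine L.hasSumLocallyUniformly_zetaRegular.hasSumLocallyUniformlyOn.differentiableOn
    (.of_forall fun s ↦ .fun_sum fun i hi ↦ ?_) L.isOpen_compl_lattice_sdiff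
  split_ifs
  · simp
  · refine .add (.add (.div (by fun_prop) (by fun_prop) fun x hx => ?_) (by fun_prop)) (by fun_prop)
    have : x ≠ i := by rintro rfl; simp_all
    simpa [sub_eq_zero]

theorem eqOn_deriv_zetaRegular :
    Set.EqOn (deriv L.zetaRegular) (fun z => -L.weierstrassPExcept 0 z) (L.lattice \ {0})ᶜ := by
  refine (L.hasSumLocallyUniformly_zetaRegular.tendstoLocallyUniformlyOn.deriv
    (.of_forall fun s ↦ ?_) L.isOpen_compl_lattice_sdiff).unique ?_
  · refine .fun_sum fun i hi ↦ ?_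
    split_ifs
    · simp
    · refine .add (.add (.div (by fun_prop) (by fun_prop) fun x hx => ?_) (by fun_prop))
        (by fun_prop)
      have : x ≠ i := by rintro rfl; simp_all
      simpa [sub_eq_zero]
  · refine (L.hasSumLocallyUniformly_weierstrassPExcept 0).neg.tendstoLocallyUniformlyOn.congr ?_
    intro s l hl
    simp only [Function.comp_apply]
    have key : ∀ i : L.lattice, HasDerivAt
        (fun z : ℂ => if i.1 = 0 then 0 else (1 / (z - i) + 1 / i + z / (i : ℂ) ^ 2))
        (-(if i.1 = 0 then 0 else (1 / (l - i) ^ 2 - 1 / (i : ℂ) ^ 2))) l := by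
      intro i
      split_ifs with hi
      · simpa using hasDerivAt_const l (0 : ℂ)
      · have h1 : l - i ≠ 0 := fun e ↦ hi (by
          obtain rfl := sub_eq_zero.mp e
          simpa using hl)
        have h2 := ((((hasDerivAt_id l).sub_const (i : ℂ)).inv h1).add_const (1 / (i : ℂ))).add
          ((hasDerivAt_id l).div_const ((i : ℂ) ^ 2))
        simp only [id] at h2
        refine (h2.congr_deriv (by ring)).congr_of_eventuallyEq (.of_forall fun z => ?_)
        simp
    rw [(HasDerivAt.fun_sum fun i _ => key i).deriv]
    simp

theorem analyticAt_zetaRegular : AnalyticAt ℂ L.zetaRegular 0 :=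
  L.differentiableOn_zetaRegular.analyticOnNhd L.isOpen_compl_lattice_sdiff _ (by simp)

theorem zero_notMem_of_notMem {z : ℂ} (hz : z ∉ L.lattice) : z ≠ 0 := by
  rintro rfl; exact hz (zero_mem _)

theorem hasDerivAt_zetaRegular {z : ℂ} (hz : z ∈ (L.lattice \ {0} : Set ℂ)ᶜ) :
    HasDerivAt L.zetaRegular (-L.weierstrassPExcept 0 z) z := by
  have h := L.eqOn_deriv_zetaRegular hz
  simp only at h
  rw [← h]
  exact (L.differentiableOn_zetaRegular.differentiableAt
    (L.isOpen_compl_lattice_sdiff.mem_nhds hz)).hasDerivAt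

theorem hasDerivAt_weierstrassZeta {z : ℂ} (hz : z ∉ L.lattice) :
    HasDerivAt L.weierstrassZeta (-L.weierstrassP z) z := by
  have h0 := L.zero_notMem_of_notMem hz
  have h1 := (hasDerivAt_inv h0).add (L.hasDerivAt_zetaRegular (z := z) (by simp [hz]))
  rw [weierstrassPExcept_zero_eq]
  refine (h1.congr_deriv (by ring)).congr_of_eventuallyEq (.of_forall fun z => ?_)
  simp [weierstrassZeta]

theorem differentiableOn_weierstrassZeta :
    DifferentiableOn ℂ L.weierstrassZeta (L.lattice : Set ℂ)ᶜ := fun _ hz =>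
  (L.hasDerivAt_weierstrassZeta hz).differentiableAt.differentiableWithinAt

theorem hasDerivAt_weierstrassP {z : ℂ} (hz : z ∉ L.lattice) :
    HasDerivAt L.weierstrassP (L.derivWeierstrassP z) z := by
  rw [← deriv_weierstrassP]
  exact (L.differentiableOn_weierstrassP.differentiableAt
    (L.isOpen_compl_lattice.mem_nhds hz)).hasDerivAt

/-- The increment of the Weierstrass zeta function along a period. -/
noncomputable def quasiPeriod (l : ℂ) : ℂ :=
  L.weierstrassZeta (L.ω₁ / 2 + l) - L.weierstrassZeta (L.ω₁ / 2)

/-- The increment has derivative zero because `℘` is periodic, and the lattice complement is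
connected; the base point `ω₁ / 2` in `quasiPeriod` is just some point off the lattice. -/
theorem weierstrassZeta_add {z l : ℂ} (hl : l ∈ L.lattice) (hz : z ∉ L.lattice) :
    L.weierstrassZeta (z + l) = L.weierstrassZeta z + L.quasiPeriod l := by
  have hd : ∀ w ∉ L.lattice,
      HasDerivAt (fun z => L.weierstrassZeta (z + l) - L.weierstrassZeta z) 0 w := by
    intro w hw
    have h1 := (L.hasDerivAt_weierstrassZeta (add_notMem_lattice hw hl)).comp_add_const w l
    refine (h1.sub (L.hasDerivAt_weierstrassZeta hw)).congr_deriv ?_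
    have := L.weierstrassP_add_coe w ⟨l, hl⟩
    simp only at this
    rw [this, sub_self]
  have := L.isOpen_compl_lattice.is_const_of_deriv_eq_zero L.isPreconnected_compl_lattice
    (fun w hw => (hd w hw).differentiableAt.differentiableWithinAt)
    (fun w hw => (hd w hw).deriv) hz L.ω₁_div_two_notMem_lattice
  rw [quasiPeriod, ← this]; ring

theorem quasiPeriod_add {l m : ℂ} (hl : l ∈ L.lattice) (hm : m ∈ L.lattice) :
    L.quasiPeriod (l + m) = L.quasiPeriod l + L.quasiPeriod m := by
  have h0 := L.ω₁_div_two_notMem_lattice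
  have h1 := L.weierstrassZeta_add hm (add_notMem_lattice h0 hl)
  rw [quasiPeriod, ← add_assoc, h1, L.weierstrassZeta_add hl h0]; ring

theorem meromorphic_weierstrassZeta : Meromorphic L.weierstrassZeta := by
  intro x
  by_cases hx : x ∈ L.lattice
  · have h0 : MeromorphicAt L.weierstrassZeta 0 := by
      have := L.analyticAt_zetaRegular.meromorphicAt
      unfold weierstrassZeta
      fun_prop
    -- Quasi-periodicity transports meromorphy from the origin to the other lattice points; only a
    -- punctured neighbourhood matters, whatever the value at the pole.
    have h1 : MeromorphicAt (fun z => L.weierstrassZeta (z - x) + L.quasiPeriod x) x := by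
      refine MeromorphicAt.add ?_ (MeromorphicAt.const _ _)
      rw [← sub_self x] at h0
      exact h0.comp_analyticAt (f := L.weierstrassZeta) (g := fun z => z - x) (by fun_prop)
    refine h1.congr ?_
    filter_upwards [self_mem_nhdsWithin, mem_nhdsWithin_of_mem_nhds
      (L.compl_lattice_sdiff_singleton_mem_nhds x)] with w hw hw'
    have hw1 : w ∉ L.lattice := by simp_all
    have hw2 : w - x ∉ L.lattice := by
      rw [sub_eq_add_neg]; exact add_notMem_lattice hw1 (neg_mem hx)
    rw [← L.weierstrassZeta_add hx hw2, sub_add_cancel]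
  · exact (L.differentiableOn_weierstrassZeta.analyticOnNhd L.isOpen_compl_lattice
      x hx).meromorphicAt

/-! ### The second derivative of `℘` and smoothness of the cubic. -/

theorem not_eventually_weierstrassP_eq (E p : ℂ) (hp : p ∉ L.lattice) :
    ¬ ∀ᶠ z in 𝓝 p, L.weierstrassP z = E := by
  intro h
  have h1 : Set.EqOn L.weierstrassP (fun _ => E) (L.lattice : Set ℂ)ᶜ :=
    L.analyticOnNhd_weierstrassP.eqOn_of_preconnected_of_eventuallyEq analyticOnNhd_const
      L.isPreconnected_compl_lattice hp h
  have h2 : L.weierstrassP =ᶠ[𝓝[≠] 0] fun _ => E := by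
    filter_upwards [self_mem_nhdsWithin, mem_nhdsWithin_of_mem_nhds
      (L.compl_lattice_sdiff_singleton_mem_nhds 0)] with w hw hw'
    exact h1 (by simp_all)
  have h3 := meromorphicOrderAt_congr h2
  rw [L.order_weierstrassP 0 (zero_mem _)] at h3
  have h4 : 0 ≤ meromorphicOrderAt (fun _ : ℂ => E) 0 :=
    (analyticAt_const (𝕜 := ℂ)).meromorphicOrderAt_nonneg
  rw [← h3] at h4
  exact absurd h4 (by decide)

/-- Differentiating `℘'² = 4℘³ - g₂℘ - g₃` gives this relation multiplied by `℘'`. Analytic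
functions on a connected set have no zero divisors, and `℘'` is not identically zero. -/
theorem deriv_derivWeierstrassP {z : ℂ} (hz : z ∉ L.lattice) :
    deriv L.derivWeierstrassP z = 6 * L.weierstrassP z ^ 2 - L.g₂ / 2 := by
  have hP := L.analyticOnNhd_weierstrassP
  have hP' := L.analyticOnNhd_derivWeierstrassP
  have hU := L.isOpen_compl_lattice
  have hd : ∀ w ∈ (L.lattice : Set ℂ)ᶜ, L.derivWeierstrassP w *
      (deriv L.derivWeierstrassP w - (6 * L.weierstrassP w ^ 2 - L.g₂ / 2)) = 0 := by
    intro w hw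
    have h1 := (hP' w hw).differentiableAt.hasDerivAt
    have h2 := L.hasDerivAt_weierstrassP hw
    have h3 := h1.pow 2
    have h4 := (((h2.pow 3).const_mul 4).sub (h2.const_mul L.g₂)).sub_const L.g₃
    have h5 := h3.unique (h4.congr_of_eventuallyEq (by
      filter_upwards [hU.mem_nhds hw] with v hv
      exact L.derivWeierstrassP_sq v hv))
    norm_num at h5
    linear_combination h5 / 2
  have han : AnalyticOnNhd ℂ (fun w => deriv L.derivWeierstrassP w -
      (6 * L.weierstrassP w ^ 2 - L.g₂ / 2)) (L.lattice : Set ℂ)ᶜ := fun w hw => by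
    have h1 := hP w hw
    have h2 := (hP' w hw).deriv
    fun_prop
  rcases hP'.eq_zero_or_eq_zero_of_mul_eq_zero han hd L.isPreconnected_compl_lattice with h | h
  · exfalso
    have h0 := L.ω₁_div_two_notMem_lattice
    refine L.not_eventually_weierstrassP_eq (L.weierstrassP (L.ω₁ / 2)) _ h0 ?_
    filter_upwards [hU.mem_nhds h0] with v hv
    exact hU.is_const_of_deriv_eq_zero L.isPreconnected_compl_lattice
      L.differentiableOn_weierstrassP (fun w hw => by rw [deriv_weierstrassP]; exact h w hw) hv h0
  · exact sub_eq_zero.mp (h z hz)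

theorem hasDerivAt_derivWeierstrassP {z : ℂ} (hz : z ∉ L.lattice) :
    HasDerivAt L.derivWeierstrassP (6 * L.weierstrassP z ^ 2 - L.g₂ / 2) z := by
  rw [← L.deriv_derivWeierstrassP hz]
  exact (L.analyticOnNhd_derivWeierstrassP z hz).differentiableAt.hasDerivAt

/-- At a zero of `℘'` the second derivative `6 ℘² - g₂ / 2` of `℘` does not vanish. -/
theorem twelve_mul_sq_ne_g₂ {p : ℂ} (hp : p ∉ L.lattice) (h : L.derivWeierstrassP p = 0) :
    12 * L.weierstrassP p ^ 2 ≠ L.g₂ := by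
  intro hg
  set E := L.weierstrassP p with hE
  have hP := L.analyticOnNhd_weierstrassP p hp
  have hP' := L.analyticOnNhd_derivWeierstrassP p hp
  have hg₃ : L.g₃ = -8 * E ^ 3 := by
    have := L.derivWeierstrassP_sq p hp
    rw [h, ← hE, ← hg] at this
    linear_combination this
  have hr : AnalyticAt ℂ (fun z => L.weierstrassP z - E) p := by fun_prop
  -- If `℘''` vanished too, `E` would be a double root of the cubic. Orders at `p` then conflict:
  -- with `ord ℘' = n` and `ord (℘ - E) = n + 1`, the left side has order `2n`, the right at least
  -- `2n + 2`, unless `℘` is constant.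
  have h1 : L.derivWeierstrassP * L.derivWeierstrassP =ᶠ[𝓝 p]
      ((fun z => L.weierstrassP z - E) * fun z => L.weierstrassP z - E) *
        fun z => 4 * (L.weierstrassP z + 2 * E) := by
    filter_upwards [L.isOpen_compl_lattice.mem_nhds hp] with z hz
    have := L.derivWeierstrassP_sq z hz
    rw [hg₃, ← hg] at this
    simp only [Pi.mul_apply]
    linear_combination this
  have h2 := analyticOrderAt_congr h1
  rw [analyticOrderAt_mul hP' hP', analyticOrderAt_mul (hr.mul hr) (by fun_prop),
    analyticOrderAt_mul hr hr] at h2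
  have h3 := hP.analyticOrderAt_deriv_add_one
  rw [deriv_weierstrassP, ← hE] at h3
  rw [← h3] at h2
  have h4 : analyticOrderAt L.derivWeierstrassP p = ⊤ := by
    by_contra hne
    lift analyticOrderAt L.derivWeierstrassP p to ℕ using hne with n hn
    have : (n + n : ℕ∞) ≥ n + 1 + (n + 1) := by rw [h2]; exact le_self_add
    norm_cast at this
    omega
  rw [h4] at h3
  have h5 := analyticOrderAt_eq_top.mp (show analyticOrderAt (fun z => L.weierstrassP z - E) p = ⊤
    from by simpa using h3.symm)
  exact L.not_eventually_weierstrassP_eq E p hp (h5.mono fun z hz => sub_eq_zero.mp hz)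

end PeriodPair

/-! ### Green's formula on parallelograms and the Legendre relation. -/

namespace MinimalTorus

open Filter Topology

/-- Green's formula on a parallelogram with sides parallel to `1` and `τ`. -/
theorem integral2_parallelogram (τ : ℂ) (W : ℂ → ℂ) (W' : ℂ → ℂ →L[ℝ] ℂ) (a b c d : ℝ)
    (hW : ∀ x ∈ Set.uIcc a b, ∀ y ∈ Set.uIcc c d, HasFDerivAt W (W' (x + y * τ)) (x + y * τ))
    (hc : ContinuousOn (fun q : ℝ × ℝ => W' (q.1 + q.2 * τ)) (Set.uIcc a b ×ˢ Set.uIcc c d)) :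
    ∫ x in a..b, ∫ y in c..d, (W' (x + y * τ) τ - τ * W' (x + y * τ) 1) =
      ((∫ x in a..b, W (x + d * τ)) - ∫ x in a..b, W (x + c * τ)) -
        τ * ((∫ y in c..d, W (b + y * τ)) - ∫ y in c..d, W (a + y * τ)) := by
  let A : ℝ × ℝ →L[ℝ] ℂ := Complex.ofRealCLM.comp (ContinuousLinearMap.fst ℝ ℝ ℝ) +
    (ContinuousLinearMap.snd ℝ ℝ ℝ).smulRight τ
  have hA : ∀ q : ℝ × ℝ, A q = q.1 + q.2 * τ := fun q => by simp [A]
  have hd : ∀ q ∈ Set.uIcc a b ×ˢ Set.uIcc c d,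
      HasFDerivAt (fun q : ℝ × ℝ => W (q.1 + q.2 * τ)) ((W' (q.1 + q.2 * τ)).comp A) q := by
    intro q hq
    have h1 : HasFDerivAt W (W' (A q)) (A q) := by rw [hA]; exact hW _ hq.1 _ hq.2
    have h2 := h1.comp q A.hasFDerivAt
    rw [hA] at h2
    exact h2.congr_of_eventuallyEq (.of_forall fun q => by simp [hA])
  have hd' : ∀ q ∈ Set.uIcc a b ×ˢ Set.uIcc c d,
      HasFDerivAt (fun q : ℝ × ℝ => -τ * W (q.1 + q.2 * τ))
        (-τ • (W' (q.1 + q.2 * τ)).comp A) q := fun q hq => (hd q hq).const_mul (-τ)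
  have hcW : ContinuousOn (fun q : ℝ × ℝ => W (q.1 + q.2 * τ))
      (Set.uIcc a b ×ˢ Set.uIcc c d) := fun q hq => (hd q hq).continuousAt.continuousWithinAt
  have hsub : Set.Ioo (min a b) (max a b) ×ˢ Set.Ioo (min c d) (max c d) ⊆
      Set.uIcc a b ×ˢ Set.uIcc c d :=
    Set.prod_mono Set.Ioo_subset_Icc_self Set.Ioo_subset_Icc_self
  -- In the coordinates `(x, y)` the field `(-τW, W)` has divergence `∂_y W - τ ∂_x W`, which is the
  -- integrand.
  have key := integral2_divergence_prod_of_hasFDerivAt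
    (fun q : ℝ × ℝ => -τ * W (q.1 + q.2 * τ)) (fun q : ℝ × ℝ => W (q.1 + q.2 * τ))
    (fun q => -τ • (W' (q.1 + q.2 * τ)).comp A) (fun q => (W' (q.1 + q.2 * τ)).comp A)
    a c b d (continuousOn_const.mul hcW) hcW (fun q hq => hd' q (hsub hq))
    (fun q hq => hd q (hsub hq)) ?_
  · have e1 : ∀ x y : ℝ, (-τ • (W' (x + y * τ)).comp A) (1, 0) + ((W' (x + y * τ)).comp A) (0, 1)
        = W' (x + y * τ) τ - τ * W' (x + y * τ) 1 := fun x y => by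
      simp [hA]; ring
    simp only [e1] at key
    rw [key]
    simp only [intervalIntegral.integral_const_mul]
    ring
  · refine ContinuousOn.integrableOn_compact (isCompact_uIcc.prod isCompact_uIcc) ?_
    simp only [smul_apply, ContinuousLinearMap.comp_apply, smul_eq_mul]
    exact (continuousOn_const.mul (hc.clm_apply continuousOn_const)).add
      (hc.clm_apply continuousOn_const)

variable (τ : UpperHalfPlane)

theorem mem_lattice_periods {x y : ℝ} :
    (x : ℂ) + y * τ ∈ (periods τ).lattice ↔ ∃ m n : ℤ, x = m ∧ y = n := by
  rw [PeriodPair.mem_lattice]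
  refine ⟨fun ⟨m, n, h⟩ => ⟨m, n, ?_⟩, fun ⟨m, n, h1, h2⟩ => ⟨m, n, ?_⟩⟩
  · simp only [periods] at h
    have hi : (n : ℝ) * τ.im = y * τ.im := by simpa using congrArg Complex.im h
    have hn : y = n := (mul_right_cancel₀ τ.im_pos.ne' hi).symm
    refine ⟨?_, hn⟩
    simpa [hn] using (congrArg Complex.re h).symm
  · simp [periods, h1, h2]

theorem notMem_lattice_of_abs {x y : ℝ} (hx : |x| < 1) (hy : |y| < 1) (h : x ≠ 0 ∨ y ≠ 0) :
    (x : ℂ) + y * τ ∉ (periods τ).lattice := by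
  rw [mem_lattice_periods]
  rintro ⟨m, n, rfl, rfl⟩
  have hm : |m| < 1 := by exact_mod_cast hx
  have hn : |n| < 1 := by exact_mod_cast hy
  rw [Int.abs_lt_one_iff] at hm hn
  simp [hm, hn] at h

theorem one_mem_lattice : (1 : ℂ) ∈ (periods τ).lattice := (periods τ).ω₁_mem_lattice

theorem tau_mem_lattice : (τ : ℂ) ∈ (periods τ).lattice := (periods τ).ω₂_mem_lattice

/-- Integrate `ζ' = -℘` along the segment defining `eta₁`, whose points have `τ`-coordinate `1/2`
and so avoid the lattice. -/
theorem eta₁_eq_quasiPeriod : eta₁ τ = (periods τ).quasiPeriod 1 := by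
  have hn : ∀ x : ℝ, (τ : ℂ) / 2 + x ∉ (periods τ).lattice := by
    intro x
    have e : (τ : ℂ) / 2 + x = (x : ℂ) + ((1 / 2 : ℝ) : ℂ) * τ := by push_cast; ring
    rw [e, mem_lattice_periods]
    rintro ⟨m, n, -, h⟩
    have h1 : (1 : ℝ) = ((2 * n : ℤ) : ℝ) := by push_cast; linarith
    have h2 : (1 : ℤ) = 2 * n := by exact_mod_cast h1
    omega
  have hd : ∀ x : ℝ, HasDerivAt (fun x : ℝ => (periods τ).weierstrassZeta ((τ : ℂ) / 2 + x))
      (-(periods τ).weierstrassP ((τ : ℂ) / 2 + x)) x := fun x => by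
    have h1 := ((periods τ).hasDerivAt_weierstrassZeta (hn x)).comp_const_add ((τ : ℂ) / 2) (x : ℂ)
    exact h1.comp_ofReal
  have hc : Continuous fun x : ℝ => -(periods τ).weierstrassP ((τ : ℂ) / 2 + x) := by
    refine Continuous.neg (continuous_iff_continuousAt.mpr fun x => ?_)
    exact ContinuousAt.comp (f := fun x : ℝ => (τ : ℂ) / 2 + x)
      ((periods τ).hasDerivAt_weierstrassP (hn x)).continuousAt (by fun_prop)
  have h := intervalIntegral.integral_eq_sub_of_hasDerivAt (a := 0) (b := 1)
    (fun x _ => hd x) (hc.intervalIntegrable 0 1)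
  rw [intervalIntegral.integral_neg] at h
  rw [eta₁, h]
  have h0 : (τ : ℂ) / 2 ∉ (periods τ).lattice := by simpa using hn 0
  simp [(periods τ).weierstrassZeta_add (one_mem_lattice τ) h0]

theorem integral_inv_eq_log {p q : ℂ} {a b : ℝ}
    (h : ∀ x ∈ Set.uIcc a b, p + x * q ∈ Complex.slitPlane) :
    q * ∫ x in a..b, (p + x * q)⁻¹ = Complex.log (p + b * q) - Complex.log (p + a * q) := by
  have hd : ∀ x ∈ Set.uIcc a b, HasDerivAt (fun x : ℝ => Complex.log (p + x * q))
      (q * (p + x * q)⁻¹) x := fun x hx => by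
    have h1 : HasDerivAt (fun z : ℂ => p + z * q) q (x : ℂ) := by
      simpa using ((hasDerivAt_id (x : ℂ)).mul_const q).const_add p
    simpa [div_eq_mul_inv] using (h1.clog (h x hx)).comp_ofReal
  have hc : ContinuousOn (fun x : ℝ => q * (p + x * q)⁻¹) (Set.uIcc a b) := by
    refine continuousOn_const.mul (ContinuousOn.inv₀ (by fun_prop) fun x hx => ?_)
    exact Complex.slitPlane_ne_zero (h x hx)
  rw [← intervalIntegral.integral_const_mul]
  exact intervalIntegral.integral_eq_sub_of_hasDerivAt hd hc.intervalIntegrable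

/-- The Legendre relation. -/
theorem legendre : τ * eta₁ τ - (periods τ).quasiPeriod τ = 2 * π * Complex.I := by
  set L := periods τ with hL
  have hIm := τ.im_pos
  have habs : ∀ {x : ℝ}, x ∈ Set.uIcc (-(1 / 2) : ℝ) (1 / 2) → |x| < 1 := fun {x} hx => by
    rw [Set.uIcc_of_le (by norm_num)] at hx
    rw [abs_lt]; constructor <;> linarith [hx.1, hx.2]
  have hmem : ∀ x ∈ Set.uIcc (-(1 / 2) : ℝ) (1 / 2), ∀ y ∈ Set.uIcc (-(1 / 2) : ℝ) (1 / 2),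
      (x : ℂ) + y * τ ∈ (L.lattice \ {0} : Set ℂ)ᶜ := by
    rintro x hx y hy ⟨h1, h2⟩
    by_cases h : x ≠ 0 ∨ y ≠ 0
    · exact notMem_lattice_of_abs τ (habs hx) (habs hy) h h1
    · push Not at h; simp [h] at h2
  have hcP : ContinuousOn (fun q : ℝ × ℝ => L.weierstrassPExcept 0 (q.1 + q.2 * τ))
      (Set.uIcc (-(1 / 2) : ℝ) (1 / 2) ×ˢ Set.uIcc (-(1 / 2) : ℝ) (1 / 2)) :=
    (L.differentiableOn_weierstrassPExcept 0).continuousOn.comp (by fun_prop)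
      fun q hq => hmem _ hq.1 _ hq.2
  -- The cell is centred at `0`, so that `0` is the only lattice point in it and `ζ - 1/z` is
  -- holomorphic there: the boundary integral vanishes. What remains is to compute the integral of
  -- `1/z`.
  have G := integral2_parallelogram τ L.zetaRegular
    (fun z => -L.weierstrassPExcept 0 z • (1 : ℂ →L[ℝ] ℂ))
    (-(1 / 2)) (1 / 2) (-(1 / 2)) (1 / 2)
    (fun x hx y hy => (L.hasDerivAt_zetaRegular (hmem x hx y hy)).complexToReal_fderiv)
    (hcP.neg.smul continuousOn_const)
  have z0 : ∀ z : ℂ, (-L.weierstrassPExcept 0 z • (1 : ℂ →L[ℝ] ℂ)) τ -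
      τ * (-L.weierstrassPExcept 0 z • (1 : ℂ →L[ℝ] ℂ)) 1 = 0 := fun z => by
    simp; ring
  simp only [z0, intervalIntegral.integral_zero] at G
  have hcZ : ContinuousOn L.zetaRegular (L.lattice \ {0} : Set ℂ)ᶜ :=
    L.differentiableOn_zetaRegular.continuousOn
  have hh : (1 / 2 : ℝ) ∈ Set.uIcc (-(1 / 2) : ℝ) (1 / 2) := Set.right_mem_uIcc
  have hh' : (-(1 / 2) : ℝ) ∈ Set.uIcc (-(1 / 2) : ℝ) (1 / 2) := Set.left_mem_uIcc
  have ix : ∀ y ∈ Set.uIcc (-(1 / 2) : ℝ) (1 / 2), IntervalIntegrable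
      (fun x : ℝ => L.zetaRegular (x + y * τ)) volume (-(1 / 2)) (1 / 2) := fun y hy =>
    (hcZ.comp (f := fun x : ℝ => (x : ℂ) + y * τ) (by fun_prop)
      fun x hx => hmem x hx y hy).intervalIntegrable
  have iy : ∀ x ∈ Set.uIcc (-(1 / 2) : ℝ) (1 / 2), IntervalIntegrable
      (fun y : ℝ => L.zetaRegular (x + y * τ)) volume (-(1 / 2)) (1 / 2) := fun x hx =>
    (hcZ.comp (f := fun y : ℝ => (x : ℂ) + y * τ) (by fun_prop)
      fun y hy => hmem x hx y hy).intervalIntegrable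
  rw [← intervalIntegral.integral_sub (ix _ hh) (ix _ hh'),
    ← intervalIntegral.integral_sub (iy _ hh) (iy _ hh')] at G
  have hslit1 : ∀ x ∈ Set.uIcc (-(1 / 2) : ℝ) (1 / 2),
      (τ : ℂ) / 2 + x * 1 ∈ Complex.slitPlane := fun x _ => by
    right; simpa using hIm.ne'
  have hslit2 : ∀ y ∈ Set.uIcc (-(1 / 2) : ℝ) (1 / 2),
      (1 : ℂ) / 2 + y * τ ∈ Complex.slitPlane := fun y _ => by
    rw [Complex.mem_slitPlane_iff]
    by_cases hy : y = 0
    · left; simp [hy]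
    · right; simpa using ⟨hy, hIm.ne'⟩
  have cinv : ∀ {f : ℝ → ℂ}, Continuous f →
      (∀ x ∈ Set.uIcc (-(1 / 2) : ℝ) (1 / 2), f x ∈ Complex.slitPlane) →
      IntervalIntegrable (fun x => (f x)⁻¹) volume (-(1 / 2)) (1 / 2) := fun hf h =>
    (hf.continuousOn.inv₀ fun x hx => Complex.slitPlane_ne_zero (h x hx)).intervalIntegrable
  have i1 := cinv (by fun_prop) hslit1
  have i2 := cinv (by fun_prop) hslit2
  -- The symmetry `z ↦ -z` identifies the integrals of `1/z` over opposite sides, so only the top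
  -- and right sides are needed, and both lie in the slit plane.
  have flip : ∀ f : ℝ → ℂ, ∫ x in (-(1 / 2) : ℝ)..(1 / 2), f (-x) =
      ∫ x in (-(1 / 2) : ℝ)..(1 / 2), f x := fun f => by
    rw [intervalIntegral.integral_comp_neg]; simp
  have X : ∫ x in (-(1 / 2) : ℝ)..(1 / 2), (L.zetaRegular (x + (1 / 2 : ℝ) * τ) -
      L.zetaRegular (x + (-(1 / 2) : ℝ) * τ)) = L.quasiPeriod τ -
        2 * ∫ x in (-(1 / 2) : ℝ)..(1 / 2), ((τ : ℂ) / 2 + x * 1)⁻¹ := by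
    have e : ∀ x ∈ Set.uIcc (-(1 / 2) : ℝ) (1 / 2), L.zetaRegular (x + (1 / 2 : ℝ) * τ) -
        L.zetaRegular (x + (-(1 / 2) : ℝ) * τ) = L.quasiPeriod τ -
          ((τ : ℂ) / 2 + x * 1)⁻¹ - ((τ : ℂ) / 2 + (-x : ℝ) * 1)⁻¹ := by
      intro x hx
      have h1 : (x : ℂ) + (-(1 / 2) : ℝ) * τ ∉ L.lattice :=
        notMem_lattice_of_abs τ (habs hx) (habs hh') (by norm_num)
      have h2 := L.weierstrassZeta_add (tau_mem_lattice τ) h1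
      have e1 : (x : ℂ) + (-(1 / 2) : ℝ) * τ + τ = x + (1 / 2 : ℝ) * τ := by push_cast; ring
      have e2 : ((τ : ℂ) / 2 + (-x : ℝ) * 1)⁻¹ = -(1 / ((x : ℂ) + (-(1 / 2) : ℝ) * τ)) := by
        rw [← div_neg, one_div]; congr 1; push_cast; ring
      have e3 : ((τ : ℂ) / 2 + x * 1)⁻¹ = 1 / ((x : ℂ) + (1 / 2 : ℝ) * τ) := by
        rw [one_div]; congr 1; push_cast; ring
      rw [e1, PeriodPair.weierstrassZeta, PeriodPair.weierstrassZeta] at h2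
      rw [e2, e3]
      linear_combination h2
    have i1' : IntervalIntegrable (fun x : ℝ => ((τ : ℂ) / 2 + (-x : ℝ) * 1)⁻¹) volume
        (-(1 / 2)) (1 / 2) := cinv (by fun_prop) fun x hx => hslit1 (-x) (by
          rw [Set.uIcc_of_le (by norm_num)] at hx ⊢; constructor <;> linarith [hx.1, hx.2])
    rw [intervalIntegral.integral_congr e, intervalIntegral.integral_sub
      (intervalIntegrable_const.sub i1) i1', intervalIntegral.integral_sub
      intervalIntegrable_const i1, flip fun x : ℝ => ((τ : ℂ) / 2 + x * 1)⁻¹]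
    norm_num
    ring
  have Y : ∫ y in (-(1 / 2) : ℝ)..(1 / 2), (L.zetaRegular ((1 / 2 : ℝ) + y * τ) -
      L.zetaRegular ((-(1 / 2) : ℝ) + y * τ)) = L.quasiPeriod 1 -
        2 * ∫ y in (-(1 / 2) : ℝ)..(1 / 2), ((1 : ℂ) / 2 + y * τ)⁻¹ := by
    have e : ∀ y ∈ Set.uIcc (-(1 / 2) : ℝ) (1 / 2), L.zetaRegular ((1 / 2 : ℝ) + y * τ) -
        L.zetaRegular ((-(1 / 2) : ℝ) + y * τ) = L.quasiPeriod 1 -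
          ((1 : ℂ) / 2 + y * τ)⁻¹ - ((1 : ℂ) / 2 + (-y : ℝ) * τ)⁻¹ := by
      intro y hy
      have h1 : ((-(1 / 2) : ℝ) : ℂ) + y * τ ∉ L.lattice :=
        notMem_lattice_of_abs τ (habs hh') (habs hy) (by norm_num)
      have h2 := L.weierstrassZeta_add (one_mem_lattice τ) h1
      have e1 : ((-(1 / 2) : ℝ) : ℂ) + y * τ + 1 = (1 / 2 : ℝ) + y * τ := by push_cast; ring
      have e2 : ((1 : ℂ) / 2 + (-y : ℝ) * τ)⁻¹ = -(1 / (((-(1 / 2) : ℝ) : ℂ) + y * τ)) := by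
        rw [← div_neg, one_div]; push_cast; ring
      have e3 : ((1 : ℂ) / 2 + y * τ)⁻¹ = 1 / (((1 / 2 : ℝ) : ℂ) + y * τ) := by
        rw [one_div]; push_cast; ring
      rw [e1, PeriodPair.weierstrassZeta, PeriodPair.weierstrassZeta] at h2
      rw [e2, e3]
      linear_combination h2
    have i2' : IntervalIntegrable (fun y : ℝ => ((1 : ℂ) / 2 + (-y : ℝ) * τ)⁻¹) volume
        (-(1 / 2)) (1 / 2) := cinv (by fun_prop) fun x hx => hslit2 (-x) (by
          rw [Set.uIcc_of_le (by norm_num)] at hx ⊢; constructor <;> linarith [hx.1, hx.2])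
    rw [intervalIntegral.integral_congr e, intervalIntegral.integral_sub
      (intervalIntegrable_const.sub i2) i2', intervalIntegral.integral_sub
      intervalIntegrable_const i2, flip fun y : ℝ => ((1 : ℂ) / 2 + y * τ)⁻¹]
    norm_num
    ring
  have A := integral_inv_eq_log hslit1
  have B := integral_inv_eq_log hslit2
  rw [X, Y] at G
  rw [one_mul] at A
  rw [A] at G
  -- The bottom right corner is the negative of the top left one; the jump of the argument by `π`
  -- gives half of `2πi`.
  have hlog : Complex.log ((1 : ℂ) / 2 + (-(1 / 2) : ℝ) * τ) =
      Complex.log ((τ : ℂ) / 2 + (-(1 / 2) : ℝ) * 1) - π * Complex.I := by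
    set w : ℂ := (τ : ℂ) / 2 + (-(1 / 2) : ℝ) * 1 with hw
    have e : (1 : ℂ) / 2 + (-(1 / 2) : ℝ) * τ = -w := by rw [hw]; push_cast; ring
    have hwi : 0 < w.im := by simpa [hw] using hIm
    rw [e, Complex.log, Complex.log, Complex.arg_neg_eq_arg_sub_pi_of_im_pos hwi, norm_neg]
    push_cast; ring
  have hlog2 : (τ : ℂ) / 2 + (1 / 2 : ℝ) * 1 = 1 / 2 + (1 / 2 : ℝ) * τ := by push_cast; ring
  rw [hlog] at B
  rw [hlog2] at G
  rw [eta₁_eq_quasiPeriod]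
  linear_combination G + 2 * B

end MinimalTorus

/-! ### The Laplacian of `log ∑ |kᵢ|²` for holomorphic `kᵢ`. -/

namespace MinimalTorus

open Filter Topology

section LogNorm

variable {ι : Type*} [Fintype ι]

/-- The complex derivative `∂_z log ∑ |kᵢ|²` for holomorphic `kᵢ`. -/
noncomputable def logNormDeriv (k : ι → ℂ → ℂ) (z : ℂ) : ℂ :=
  (∑ i, deriv (k i) z * conj (k i z)) / ∑ i, k i z * conj (k i z)

theorem sum_mul_conj_eq (k : ι → ℂ → ℂ) (z : ℂ) :
    ∑ i, k i z * conj (k i z) = ((∑ i, ‖k i z‖ ^ 2 : ℝ) : ℂ) := by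
  push_cast
  exact Finset.sum_congr rfl fun i _ => Complex.mul_conj' _

theorem sum_norm_sq_pos {k : ι → ℂ → ℂ} {z : ℂ} (h : ∃ i, k i z ≠ 0) :
    0 < ∑ i, ‖k i z‖ ^ 2 := by
  obtain ⟨i, hi⟩ := h
  exact Finset.sum_pos' (fun _ _ => by positivity) ⟨i, Finset.mem_univ _, by positivity⟩

theorem sum_mul_conj_ne_zero {k : ι → ℂ → ℂ} {z : ℂ} (h : ∃ i, k i z ≠ 0) :
    ∑ i, k i z * conj (k i z) ≠ 0 := by
  rw [sum_mul_conj_eq]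
  exact_mod_cast (sum_norm_sq_pos h).ne'

/-- The pairing `(q, v) ↦ 2 Re (q v)`. -/
noncomputable def twoRe : ℂ →L[ℝ] ℂ →L[ℝ] ℝ :=
  (ContinuousLinearMap.compL ℝ ℂ ℂ ℝ ((2 : ℝ) • Complex.reCLM)).comp (ContinuousLinearMap.mul ℝ ℂ)

@[simp] theorem twoRe_apply (q v : ℂ) : twoRe q v = 2 * (q * v).re := by
  simp [twoRe]

/-- For a real function `φ` one has `dφ(v) = 2 Re (∂_z φ · v)`; this form lets the second
differentiation act on the complex function `logNormDeriv`. -/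
theorem hasFDerivAt_log_sum_norm_sq {k : ι → ℂ → ℂ} {z : ℂ}
    (hk : ∀ i, DifferentiableAt ℂ (k i) z) (h : ∃ i, k i z ≠ 0) :
    HasFDerivAt (fun w => Real.log (∑ i, ‖k i w‖ ^ 2)) (twoRe (logNormDeriv k z)) z := by
  have h1 : ∀ i, HasFDerivAt (fun w => ‖k i w‖ ^ 2)
      (twoRe (deriv (k i) z * conj (k i z))) z := fun i => by
    refine ((hk i).hasDerivAt.complexToReal_fderiv.norm_sq).congr_fderiv ?_
    ext v
    simp [Complex.inner]
    ring
  have h2 := (HasFDerivAt.fun_sum fun i (_ : i ∈ Finset.univ) => h1 i).log (sum_norm_sq_pos h).ne'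
  refine h2.congr_fderiv ?_
  rw [← map_sum, ← map_smul, logNormDeriv, sum_mul_conj_eq]
  congr 1
  rw [Complex.real_smul, div_eq_inv_mul]
  push_cast; ring

theorem contDiffAt_logNormDeriv {k : ι → ℂ → ℂ} {z : ℂ}
    (hk : ∀ i, AnalyticAt ℂ (k i) z) (h : ∃ i, k i z ≠ 0) :
    ContDiffAt ℝ 1 (logNormDeriv k) z := by
  have h1 : ∀ i, ContDiffAt ℝ 1 (k i) z := fun i => (hk i).contDiffAt.restrict_scalars ℝ
  have h2 : ∀ i, ContDiffAt ℝ 1 (deriv (k i)) z := fun i =>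
    (hk i).deriv.contDiffAt.restrict_scalars ℝ
  have h3 : ∀ i, ContDiffAt ℝ 1 (fun w => conj (k i w)) z := fun i =>
    Complex.conjCLE.contDiff.contDiffAt.comp z (h1 i)
  have h4 : ContDiffAt ℝ 1 (fun w => ∑ i, deriv (k i) w * conj (k i w)) z :=
    ContDiffAt.sum fun i _ => (h2 i).mul (h3 i)
  have h5 : ContDiffAt ℝ 1 (fun w => ∑ i, k i w * conj (k i w)) z :=
    ContDiffAt.sum fun i _ => (h1 i).mul (h3 i)
  refine (h4.mul (h5.inv (sum_mul_conj_ne_zero h))).congr_of_eventuallyEq (.of_forall fun w => ?_)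
  simp only [logNormDeriv, div_eq_mul_inv]
  rfl

/-- This is `Δ = 4 ∂_z̄ ∂_z`, with `2 ∂_z̄ = ∂_x + i ∂_y` applied to `∂_z log ∑ |kᵢ|²`. -/
theorem laplacian_log_sum_norm_sq {k : ι → ℂ → ℂ} {U : Set ℂ} (hU : IsOpen U)
    (hk : ∀ i, AnalyticOnNhd ℂ (k i) U) (h : ∀ z ∈ U, ∃ i, k i z ≠ 0) {z : ℂ} (hz : z ∈ U) :
    (Δ (fun w => Real.log (∑ i, ‖k i w‖ ^ 2))) z =
      2 * (fderiv ℝ (logNormDeriv k) z 1 + Complex.I * fderiv ℝ (logNormDeriv k) z Complex.I).re := by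
  have h1 : fderiv ℝ (fun w => Real.log (∑ i, ‖k i w‖ ^ 2)) =ᶠ[𝓝 z]
      fun w => twoRe (logNormDeriv k w) := by
    filter_upwards [hU.mem_nhds hz] with w hw
    exact (hasFDerivAt_log_sum_norm_sq (fun i => (hk i w hw).differentiableAt) (h w hw)).fderiv
  have h2 : HasFDerivAt (fun w => twoRe (logNormDeriv k w))
      (twoRe.comp (fderiv ℝ (logNormDeriv k) z)) z :=
    twoRe.hasFDerivAt.comp z ((contDiffAt_logNormDeriv (fun i => hk i z hz)
      (h z hz)).differentiableAt one_ne_zero).hasFDerivAt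
  rw [InnerProductSpace.laplacian_eq_iteratedFDeriv_complexPlane]
  simp only [iteratedFDeriv_two_apply, h1.fderiv_eq, h2.fderiv]
  simp
  ring

/-- The sum of squares is multiplied by `|z|^(2N)`, and `∂_z log |z|^(2N) = N / z`. This isolates
the pole of `logNormDeriv` at the puncture. -/
theorem logNormDeriv_mul_pow {k K : ι → ℂ → ℂ} {N : ℕ} {z : ℂ} (hz : z ≠ 0)
    (hk : ∀ i, DifferentiableAt ℂ (k i) z) (h : ∃ i, k i z ≠ 0)
    (hK : ∀ i, K i =ᶠ[𝓝 z] fun w => k i w * w ^ N) :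
    logNormDeriv K z = logNormDeriv k z + N / z := by
  have h1 : ∀ i, deriv (K i) z = (deriv (k i) z + N / z * k i z) * z ^ N := fun i => by
    rw [(hK i).deriv_eq, ((hk i).hasDerivAt.fun_mul (hasDerivAt_pow N z)).deriv]
    rcases N with _ | n
    · simp
    · rw [Nat.add_sub_cancel]; field_simp; ring
  have h2 : ∀ i, K i z = k i z * z ^ N := fun i => (hK i).self_of_nhds
  have h3 := sum_mul_conj_ne_zero h
  have hc : z ^ N * conj (z ^ N) ≠ 0 := by
    have : z ^ N ≠ 0 := pow_ne_zero _ hz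
    simpa using this
  have h4 : ∑ i, deriv (K i) z * conj (K i z) = (∑ i, deriv (k i) z * conj (k i z) +
      N / z * ∑ i, k i z * conj (k i z)) * (z ^ N * conj (z ^ N)) := by
    rw [Finset.mul_sum, ← Finset.sum_add_distrib, Finset.sum_mul]
    refine Finset.sum_congr rfl fun i _ => ?_
    rw [h1, h2, map_mul]; ring
  have h5 : ∑ i, K i z * conj (K i z) = (∑ i, k i z * conj (k i z)) * (z ^ N * conj (z ^ N)) := by
    rw [Finset.sum_mul]
    refine Finset.sum_congr rfl fun i _ => ?_
    rw [h2, map_mul]; ring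
  rw [logNormDeriv, h4, h5, mul_div_mul_right _ _ hc, add_div, mul_div_assoc, div_self h3, mul_one,
    logNormDeriv]

end LogNorm

/-! ### Integration over the period cell. -/

section Cell

variable (τ : UpperHalfPlane)

/-- The real-linear automorphism `x + i y ↦ x + y τ` of `ℂ`. -/
noncomputable def cellMap : ℂ →L[ℝ] ℂ :=
  Complex.ofRealCLM.comp Complex.reCLM + Complex.imCLM.smulRight (τ : ℂ)

theorem cellMap_apply (z : ℂ) : cellMap τ z = z.re + z.im * τ := by simp [cellMap]

theorem cellMap_injective : Function.Injective (cellMap τ) := by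
  intro z w h
  simp only [cellMap_apply] at h
  have h1 : z.im * τ.im = w.im * τ.im := by simpa using congrArg Complex.im h
  have h2 : z.im = w.im := mul_right_cancel₀ τ.im_pos.ne' h1
  refine Complex.ext ?_ h2
  simpa [h2] using congrArg Complex.re h

theorem det_cellMap : (cellMap τ).det = τ.im := by
  rw [ContinuousLinearMap.det, ← LinearMap.det_toMatrix Complex.basisOneI, Matrix.det_fin_two]
  simp [LinearMap.toMatrix_apply, cellMap_apply]

theorem puncturedCell_eq : puncturedCell (periods τ) =
    cellMap τ '' ((Set.Ico 0 1 ×ℂ Set.Ico 0 1) \ {0}) := by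
  ext z
  constructor
  · rintro ⟨h0, x, hx, y, hy, rfl⟩
    refine ⟨⟨x, y⟩, ⟨⟨hx, hy⟩, ?_⟩, by simp [cellMap_apply, periods]⟩
    rintro h
    have h1 : x = 0 := congrArg Complex.re h
    have h2 : y = 0 := congrArg Complex.im h
    simp [h1, h2] at h0
  · rintro ⟨w, ⟨⟨hx, hy⟩, hw⟩, rfl⟩
    refine ⟨fun h => hw ?_, w.re, hx, w.im, hy, by simp [cellMap_apply, periods]⟩
    exact cellMap_injective τ (h.trans (map_zero _).symm)

theorem measurableSet_unitCell : MeasurableSet ((Set.Ico (0 : ℝ) 1 ×ℂ Set.Ico (0 : ℝ) 1) \ {0}) :=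
  ((measurableSet_Ico.preimage Complex.measurable_re).inter
    (measurableSet_Ico.preimage Complex.measurable_im)).diff (measurableSet_singleton 0)

theorem measurableSet_puncturedCell : MeasurableSet (puncturedCell (periods τ)) := by
  rw [puncturedCell_eq]
  exact measurableSet_unitCell.image_of_continuousOn_injOn (cellMap τ).continuous.continuousOn
    (cellMap_injective τ).injOn

theorem notMem_lattice_of_mem_puncturedCell {z : ℂ} (hz : z ∈ puncturedCell (periods τ)) :
    z ∉ (periods τ).lattice := by
  obtain ⟨h0, x, hx, y, hy, rfl⟩ := hz
  have e : (x : ℂ) * (periods τ).ω₁ + y * (periods τ).ω₂ = x + y * τ := by simp [periods]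
  rw [e] at h0 ⊢
  refine notMem_lattice_of_abs τ (abs_lt.mpr ⟨by linarith [hx.1], hx.2⟩)
    (abs_lt.mpr ⟨by linarith [hy.1], hy.2⟩) ?_
  by_contra h
  push Not at h
  simp [h] at h0

theorem integrableOn_puncturedCell {g : ℂ → ℝ} (hg : Continuous g) :
    IntegrableOn g (puncturedCell (periods τ)) := by
  have hc : IsCompact (cellMap τ '' (Set.Icc 0 1 ×ℂ Set.Icc 0 1)) :=
    (isCompact_Icc.reProdIm isCompact_Icc).image (cellMap τ).continuous
  refine (hg.continuousOn.integrableOn_compact hc).mono_set ?_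
  rw [puncturedCell_eq]
  refine Set.image_mono fun z hz => ?_
  exact ⟨Set.Ico_subset_Icc_self hz.1.1, Set.Ico_subset_Icc_self hz.1.2⟩

theorem setIntegral_puncturedCell {g : ℂ → ℝ} (hg : Continuous g) :
    ∫ z in puncturedCell (periods τ), g z =
      ∫ x in (0 : ℝ)..1, ∫ y in (0 : ℝ)..1, τ.im * g (x + y * τ) := by
  rw [puncturedCell_eq, integral_image_eq_integral_abs_det_fderiv_smul volume
    measurableSet_unitCell (fun z _ => (cellMap τ).hasFDerivWithinAt)
    (cellMap_injective τ).injOn]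
  -- The removed vertex is a null set, and the Jacobian of `cellMap` is `Im τ`.
  rw [setIntegral_congr_set (sdiff_null_ae_eq_self (measure_singleton 0)), det_cellMap,
    abs_of_pos τ.im_pos]
  have e : (Set.Ico (0 : ℝ) 1 ×ℂ Set.Ico (0 : ℝ) 1) =
      Complex.measurableEquivRealProd ⁻¹' (Set.Ico 0 1 ×ˢ Set.Ico 0 1) := rfl
  have h := Complex.volume_preserving_equiv_real_prod.setIntegral_preimage_emb
    Complex.measurableEquivRealProd.measurableEmbedding
    (fun q : ℝ × ℝ => τ.im • g (q.1 + q.2 * τ)) (Set.Ico 0 1 ×ˢ Set.Ico 0 1)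
  simp only [Complex.measurableEquivRealProd_apply] at h
  simp only [cellMap_apply, e, h]
  rw [Measure.volume_eq_prod, setIntegral_prod]
  · simp only [intervalIntegral.integral_of_le zero_le_one, integral_Ico_eq_integral_Ioc,
      smul_eq_mul]
  · refine (ContinuousOn.integrableOn_compact (isCompact_Icc.prod isCompact_Icc)
      (Continuous.continuousOn (by fun_prop))).mono_set
      (Set.prod_mono Set.Ico_subset_Icc_self Set.Ico_subset_Icc_self)

end Cell

end MinimalTorus

/-! ### The integral of `Δ log ∑ |kᵢ|²` for an elliptic frame. -/

namespace MinimalTorus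

open Filter Topology

variable {ι : Type*} [Fintype ι]

/-- Holomorphic functions `kᵢ` off the lattice, periodic and without common zeros, with poles of
order at most `N` at the lattice points, where the order `N` is attained. -/
structure IsEllipticFrame (L : PeriodPair) (k : ι → ℂ → ℂ) (N : ℕ) : Prop where
  analytic : ∀ i, AnalyticOnNhd ℂ (k i) (L.lattice : Set ℂ)ᶜ
  periodic : ∀ i, ∀ l ∈ L.lattice, ∀ z ∉ L.lattice, k i (z + l) = k i z
  exists_ne_zero : ∀ z ∉ L.lattice, ∃ i, k i z ≠ 0
  exists_regular : ∃ K : ι → ℂ → ℂ, (∀ i, AnalyticAt ℂ (K i) 0) ∧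
    (∀ i, ∀ z ∉ L.lattice, K i z = k i z * z ^ N) ∧ ∃ i, K i 0 ≠ 0

namespace IsEllipticFrame

variable {L : PeriodPair} {k : ι → ℂ → ℂ} {N : ℕ} (hk : IsEllipticFrame L k N)
include hk

theorem logNormDeriv_add {l z : ℂ} (hl : l ∈ L.lattice) (hz : z ∉ L.lattice) :
    logNormDeriv k (z + l) = logNormDeriv k z := by
  have h1 : ∀ i, deriv (k i) (z + l) = deriv (k i) z := fun i => by
    rw [← deriv_comp_add_const]
    refine Filter.EventuallyEq.deriv_eq ?_
    filter_upwards [L.isOpen_compl_lattice.mem_nhds hz] with w hw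
    exact hk.periodic i l hl w hw
  simp only [logNormDeriv, h1, hk.periodic _ l hl z hz]

/-- The sum of `∂_z log ∑ |kᵢ|²` and `N ζ` extends smoothly to the plane. -/
theorem exists_smooth_extension : ∃ W : ℂ → ℂ, ContDiff ℝ 1 W ∧
    (∀ z ∉ L.lattice, W z = logNormDeriv k z + N * L.weierstrassZeta z) ∧
    ∀ l ∈ L.lattice, ∀ z, W (z + l) = W z + N * L.quasiPeriod l := by
  classical
  obtain ⟨K, hK, hKk, hK0⟩ := hk.exists_regular
  -- Near `0` the pole `-N/z` of `logNormDeriv k` cancels that of `Nζ`, which dictates the value at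
  -- `0`; quasi-periodicity dictates the values at the other lattice points.
  let W : ℂ → ℂ := fun z => if z ∈ L.lattice then
      logNormDeriv K 0 + N * L.zetaRegular 0 + N * L.quasiPeriod z
    else logNormDeriv k z + N * L.weierstrassZeta z
  have hWoff : ∀ z ∉ L.lattice, W z = logNormDeriv k z + N * L.weierstrassZeta z :=
    fun z hz => if_neg hz
  have hWon : ∀ z ∈ L.lattice, W z =
      logNormDeriv K 0 + N * L.zetaRegular 0 + N * L.quasiPeriod z := fun z hz => if_pos hz
  have hadd : ∀ l ∈ L.lattice, ∀ z, W (z + l) = W z + N * L.quasiPeriod l := by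
    intro l hl z
    by_cases hz : z ∈ L.lattice
    · rw [hWon _ hz, hWon _ (add_mem hz hl), L.quasiPeriod_add hz hl]; ring
    · rw [hWoff _ hz, hWoff _ (PeriodPair.add_notMem_lattice hz hl), hk.logNormDeriv_add hl hz,
        L.weierstrassZeta_add hl hz]
      ring
  have hq0 : L.quasiPeriod 0 = 0 := by simp [PeriodPair.quasiPeriod]
  have h0 : ContDiffAt ℝ 1 W 0 := by
    have h1 : ContDiffAt ℝ 1 (fun z => logNormDeriv K z + N * L.zetaRegular z) 0 :=
      (contDiffAt_logNormDeriv hK hK0).add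
        (contDiffAt_const.mul (L.analyticAt_zetaRegular.contDiffAt.restrict_scalars ℝ))
    refine h1.congr_of_eventuallyEq ?_
    filter_upwards [L.compl_lattice_sdiff_singleton_mem_nhds 0] with z hz
    by_cases hz0 : z = 0
    · rw [hz0, hWon _ (zero_mem _), hq0]; simp
    · have hzL : z ∉ L.lattice := by simp_all
      have hUz := L.isOpen_compl_lattice.mem_nhds hzL
      rw [hWoff _ hzL, logNormDeriv_mul_pow hz0 (fun i => (hk.analytic i z hzL).differentiableAt)
        (hk.exists_ne_zero z hzL) (K := K) (N := N) fun i => ?_, PeriodPair.weierstrassZeta]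
      · ring
      · filter_upwards [hUz] with w hw
        exact hKk i w hw
  refine ⟨W, contDiff_iff_contDiffAt.mpr fun z => ?_, hWoff, hadd⟩
  by_cases hz : z ∈ L.lattice
  · have e : W = fun w => W (w - z) + N * L.quasiPeriod z := by
      ext w; rw [← hadd z hz, sub_add_cancel]
    rw [e]
    refine ContDiffAt.add ?_ contDiffAt_const
    rw [← sub_self z] at h0
    exact h0.comp (f := fun w => w - z) z (by fun_prop)
  · have h1 : ContDiffAt ℝ 1 (fun z => logNormDeriv k z + N * L.weierstrassZeta z) z :=
      (contDiffAt_logNormDeriv (fun i => hk.analytic i z hz) (hk.exists_ne_zero z hz)).add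
        (contDiffAt_const.mul ((L.differentiableOn_weierstrassZeta.analyticOnNhd
          L.isOpen_compl_lattice z hz).contDiffAt.restrict_scalars ℝ))
    refine h1.congr_of_eventuallyEq ?_
    filter_upwards [L.isOpen_compl_lattice.mem_nhds hz] with w hw
    exact hWoff w hw

/-- Adding `Nζ` changes nothing, because `∂_z̄` annihilates the holomorphic `ζ`. -/
theorem laplacian_eq {W : ℂ → ℂ}
    (hW : ∀ z ∉ L.lattice, W z = logNormDeriv k z + N * L.weierstrassZeta z)
    {z : ℂ} (hz : z ∉ L.lattice) : (Δ (fun w => Real.log (∑ i, ‖k i w‖ ^ 2))) z =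
      2 * (fderiv ℝ W z 1 + Complex.I * fderiv ℝ W z Complex.I).re := by
  rw [laplacian_log_sum_norm_sq L.isOpen_compl_lattice hk.analytic hk.exists_ne_zero hz]
  have h1 := ((contDiffAt_logNormDeriv (fun i => hk.analytic i z hz)
    (hk.exists_ne_zero z hz)).differentiableAt one_ne_zero).hasFDerivAt
  have h2 := ((L.hasDerivAt_weierstrassZeta hz).const_mul (N : ℂ)).complexToReal_fderiv
  have h3 : HasFDerivAt W _ z := (h1.add h2).congr_of_eventuallyEq (by
    filter_upwards [L.isOpen_compl_lattice.mem_nhds hz] with w hw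
    exact hW w hw)
  rw [h3.fderiv]
  congr 2
  simp
  linear_combination (N * L.weierstrassP z) * Complex.I_mul_I

end IsEllipticFrame

/-- Green's formula for the smooth extension `W` leaves only its increments across the cell, `N
(η(τ) - τ η(1)) = -2πiN` by Legendre; applying `2 Re (i ·)` gives `4πN`. -/
theorem integral_laplacian_log {τ : UpperHalfPlane} {k : ι → ℂ → ℂ} {N : ℕ}
    (hk : IsEllipticFrame (periods τ) k N) :
    IntegrableOn (Δ (fun w => Real.log (∑ i, ‖k i w‖ ^ 2))) (puncturedCell (periods τ)) ∧
      ∫ z in puncturedCell (periods τ), (Δ (fun w => Real.log (∑ i, ‖k i w‖ ^ 2))) z =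
        4 * π * N := by
  obtain ⟨W, hW, hWoff, hadd⟩ := hk.exists_smooth_extension
  have hcW : Continuous (fderiv ℝ W) := hW.continuous_fderiv one_ne_zero
  set g : ℂ → ℝ := fun z => 2 * (fderiv ℝ W z 1 + Complex.I * fderiv ℝ W z Complex.I).re with hg
  have hgc : Continuous g := by
    have h1 := hcW.clm_apply (continuous_const (y := (1 : ℂ)))
    have h2 := hcW.clm_apply (continuous_const (y := Complex.I))
    exact continuous_const.mul (Complex.continuous_re.comp (h1.add (continuous_const.mul h2)))
  have heq : Set.EqOn (Δ (fun w => Real.log (∑ i, ‖k i w‖ ^ 2))) g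
      (puncturedCell (periods τ)) := fun z hz =>
    hk.laplacian_eq hWoff (notMem_lattice_of_mem_puncturedCell τ hz)
  have hm := measurableSet_puncturedCell τ
  refine ⟨(integrableOn_congr_fun heq hm).mpr (integrableOn_puncturedCell τ hgc), ?_⟩
  rw [setIntegral_congr_fun hm heq, setIntegral_puncturedCell τ hgc]
  -- Rewrites the Laplacian times the Jacobian as the divergence in Green's formula, using `τ = Re τ
  -- + i Im τ`.
  have e1 : ∀ z : ℂ, τ.im * g z = twoRe Complex.I (fderiv ℝ W z τ - τ * fderiv ℝ W z 1) := by
    intro z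
    have h1 : fderiv ℝ W z τ = τ.re * fderiv ℝ W z 1 + τ.im * fderiv ℝ W z Complex.I := by
      conv_lhs => rw [← Complex.re_add_im (τ : ℂ)]
      rw [map_add, ← mul_one ((τ : ℂ).re : ℂ), ← Complex.real_smul, ← Complex.real_smul, map_smul,
        map_smul]
      simp
    rw [h1]
    simp [hg]
    ring
  have hcon : Continuous fun q : ℝ × ℝ =>
      fderiv ℝ W (q.1 + q.2 * τ) τ - τ * fderiv ℝ W (q.1 + q.2 * τ) 1 := by
    have h0 : Continuous fun q : ℝ × ℝ => fderiv ℝ W (q.1 + q.2 * τ) := hcW.comp (by fun_prop)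
    exact (h0.clm_apply continuous_const).sub (continuous_const.mul (h0.clm_apply continuous_const))
  simp only [e1]
  have e2 : ∀ x : ℝ, ∫ y in (0 : ℝ)..1, twoRe Complex.I (fderiv ℝ W (x + y * τ) τ -
      τ * fderiv ℝ W (x + y * τ) 1) = twoRe Complex.I (∫ y in (0 : ℝ)..1,
        (fderiv ℝ W (x + y * τ) τ - τ * fderiv ℝ W (x + y * τ) 1)) := fun x =>
    (twoRe Complex.I).intervalIntegral_comp_comm
      ((hcon.comp (f := fun y : ℝ => (x, y)) (by fun_prop)).intervalIntegrable _ _)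
  simp only [e2]
  rw [ContinuousLinearMap.intervalIntegral_comp_comm, integral2_parallelogram τ W (fderiv ℝ W)
    0 1 0 1 (fun x _ y _ => (hW.differentiable one_ne_zero _).hasFDerivAt)
    (hcW.comp (by fun_prop)).continuousOn]
  · have i1 : ∀ w : ℂ, IntervalIntegrable (fun x : ℝ => W (x + w)) volume 0 1 := fun w =>
      (hW.continuous.comp (by fun_prop)).intervalIntegrable _ _
    have i2 : ∀ w : ℂ, IntervalIntegrable (fun y : ℝ => W (w + y * τ)) volume 0 1 := fun w =>
      (hW.continuous.comp (by fun_prop)).intervalIntegrable _ _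
    have a1 : ∀ x : ℝ, W (x + (1 : ℝ) * τ) = W (x + (0 : ℝ) * τ) +
        N * (periods τ).quasiPeriod τ := fun x => by
      rw [← hadd _ (tau_mem_lattice τ)]; simp
    have a2 : ∀ y : ℝ, W ((1 : ℝ) + y * τ) = W ((0 : ℝ) + y * τ) +
        N * (periods τ).quasiPeriod 1 := fun y => by
      rw [← hadd _ (one_mem_lattice τ)]; congr 1; push_cast; ring
    simp only [a1, a2]
    rw [intervalIntegral.integral_add (i1 _) intervalIntegrable_const,
      intervalIntegral.integral_add (i2 _) intervalIntegrable_const]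
    have hl := legendre τ
    rw [eta₁_eq_quasiPeriod] at hl
    have e3 : ((periods τ).quasiPeriod τ : ℂ) = τ * (periods τ).quasiPeriod 1 -
      2 * π * Complex.I := by linear_combination -hl
    rw [e3]
    simp
    ring
  · exact (intervalIntegral.continuous_parametric_intervalIntegral_of_continuous' hcon
      0 1).intervalIntegrable _ _

end MinimalTorus

/-! ### From holomorphic primitives to a solution of the Main Problem. -/

namespace MinimalTorus

open Filter Topology

theorem norm_ofC2_sq (X Y : ℂ) : ‖ofC2 X Y‖ ^ 2 = ‖X‖ ^ 2 + ‖Y‖ ^ 2 := by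
  rw [EuclideanSpace.norm_sq_eq, Fin.sum_univ_four, Complex.sq_norm, Complex.sq_norm,
    Complex.normSq_apply, Complex.normSq_apply]
  simp [ofC2]
  ring

/-- The real-linear map `(e, f, g, h) ↦ (e + conj f, g + conj h)`. -/
noncomputable def assemble : (Fin 4 → ℂ) →L[ℝ] R4 :=
  LinearMap.toContinuousLinearMap
    { toFun := fun v => ofC2 (v 0 + conj (v 1)) (v 2 + conj (v 3))
      map_add' := fun v w => by
        ext i; fin_cases i <;> simp [ofC2] <;> ring
      map_smul' := fun r v => by
        ext i; fin_cases i <;> simp [ofC2] <;> ring }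

theorem assemble_apply (v : Fin 4 → ℂ) :
    assemble v = ofC2 (v 0 + conj (v 1)) (v 2 + conj (v 3)) := rfl

/-- Expanding the squares leaves the cross term `2 Re (v² (k₀k₁ + k₂k₃))`, which isotropy kills.
Hence the differential scales all lengths equally. -/
theorem norm_assemble_smul_sq {k : Fin 4 → ℂ} (hk : k 0 * k 1 + k 2 * k 3 = 0) (v : ℂ) :
    ‖assemble (v • k)‖ ^ 2 = ‖v‖ ^ 2 * ∑ i, ‖k i‖ ^ 2 := by
  have h1 := congrArg Complex.re hk
  have h2 := congrArg Complex.im hk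
  simp at h1 h2
  rw [assemble_apply, norm_ofC2_sq, Fin.sum_univ_four]
  simp only [Complex.sq_norm, Complex.normSq_apply]
  simp
  linear_combination (2 * v.re ^ 2 - 2 * v.im ^ 2) * h1 - 4 * v.re * v.im * h2

theorem norm_ge_of_assemble (v : Fin 4 → ℂ) : ‖v 0‖ - ‖v 1‖ ≤ ‖assemble v‖ := by
  have h1 : ‖v 0 + conj (v 1)‖ ≤ ‖assemble v‖ := by
    rw [← abs_of_nonneg (norm_nonneg (assemble v)), ← abs_of_nonneg (norm_nonneg (v 0 + _)),
      ← sq_le_sq, assemble_apply, norm_ofC2_sq]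
    nlinarith [sq_nonneg ‖v 2 + conj (v 3)‖]
  have h2 := norm_sub_le_norm_add (v 0) (conj (v 1))
  rw [Complex.norm_conj] at h2
  linarith

/-- Primitives `E` of the components `k` of a conformal frame, which assemble to a map `F` on the
torus, with leading behaviour `c / z ^ 3` of the first primitive at the origin. -/
structure IsRepresentation (L : PeriodPair) (F : Torus L → R4) (E k : Fin 4 → ℂ → ℂ) (c : ℂ) :
    Prop where
  hasDerivAt : ∀ i, ∀ z ∉ L.lattice, HasDerivAt (E i) (k i z) z
  frame : IsEllipticFrame L k 4
  conformal : ∀ z ∉ L.lattice, k 0 z * k 1 z + k 2 z * k 3 z = 0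
  eq_assemble : ∀ z ∉ L.lattice, F (proj L z) = assemble fun i => E i z
  ne_zero : c ≠ 0
  tendsto : ∀ i, Tendsto (fun z => z ^ 3 * E i z) (𝓝[≠] 0) (𝓝 (if i = 0 then c else 0))

theorem proj_eq_proj {L : PeriodPair} {z w : ℂ} : proj L z = proj L w ↔ z - w ∈ L.lattice :=
  Submodule.Quotient.eq _

theorem proj_eq_zero {L : PeriodPair} {z : ℂ} : proj L z = 0 ↔ z ∈ L.lattice :=
  Submodule.Quotient.mk_eq_zero _

theorem isOpenQuotientMap_proj (L : PeriodPair) : IsOpenQuotientMap (proj L) :=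
  L.lattice.isOpenQuotientMap_mkQ

theorem compactSpace_torus (L : PeriodPair) : CompactSpace (Torus L) := by
  refine ⟨?_⟩
  rw [← (isOpenQuotientMap_proj L).surjective.range_eq]
  refine IsZLattice.isCompact_range_of_periodic L.lattice _
    (isOpenQuotientMap_proj L).continuous fun z w hw => ?_
  rw [proj_eq_proj]
  simpa using hw

theorem isClosed_compl_image_ball (L : PeriodPair) (ε : ℝ) : IsClosed (proj L '' Metric.ball 0 ε)ᶜ :=
  ((isOpenQuotientMap_proj L).isOpenMap _ Metric.isOpen_ball).isClosed_compl

namespace IsRepresentation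

variable {L : PeriodPair} {F : Torus L → R4} {E k : Fin 4 → ℂ → ℂ} {c : ℂ}
  (h : IsRepresentation L F E k c)
include h

theorem eventually_eq {z : ℂ} (hz : z ∉ L.lattice) :
    (fun z => F (proj L z)) =ᶠ[𝓝 z] fun z => assemble fun i => E i z := by
  filter_upwards [L.isOpen_compl_lattice.mem_nhds hz] with w hw
  exact h.eq_assemble w hw

theorem hasFDerivAt {z : ℂ} (hz : z ∉ L.lattice) :
    HasFDerivAt (fun z => F (proj L z)) (assemble.comp
      (ContinuousLinearMap.pi fun i => k i z • (1 : ℂ →L[ℝ] ℂ))) z := by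
  have h1 : HasFDerivAt (fun z i => E i z)
      (ContinuousLinearMap.pi fun i => k i z • (1 : ℂ →L[ℝ] ℂ)) z :=
    hasFDerivAt_pi.mpr fun i => (h.hasDerivAt i z hz).complexToReal_fderiv
  exact (assemble.hasFDerivAt.comp z h1).congr_of_eventuallyEq (h.eventually_eq hz)

theorem norm_fderiv_apply_sq {z : ℂ} (hz : z ∉ L.lattice) (v : ℂ) :
    ‖fderiv ℝ (fun z => F (proj L z)) z v‖ ^ 2 = ‖v‖ ^ 2 * ∑ i, ‖k i z‖ ^ 2 := by
  rw [(h.hasFDerivAt hz).fderiv, ← norm_assemble_smul_sq (h.conformal z hz) v]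
  have e : (ContinuousLinearMap.pi fun i => k i z • (1 : ℂ →L[ℝ] ℂ)) v = v • fun i => k i z := by
    ext i
    simp [mul_comm]
  rw [ContinuousLinearMap.comp_apply, e]

theorem conformalFactor_eq {z : ℂ} (hz : z ∉ L.lattice) :
    conformalFactor (fun z => F (proj L z)) z = ∑ i, ‖k i z‖ ^ 2 := by
  rw [conformalFactor, h.norm_fderiv_apply_sq hz]; simp

theorem isMinimalImmersion : IsMinimalImmersion L F where
  harmonic z hz := by
    rw [InnerProductSpace.harmonicAt_congr_nhds (h.eventually_eq hz)]
    have h1 : AnalyticAt ℂ (fun z i => E i z) z := by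
      refine analyticAt_pi_iff.mpr fun i => ?_
      exact DifferentiableOn.analyticAt
        (fun w hw => (h.hasDerivAt i w hw).differentiableAt.differentiableWithinAt)
        (L.isOpen_compl_lattice.mem_nhds hz)
    exact (AnalyticAt.harmonicAt h1).comp_CLM assemble
  conformal z hz := by
    refine ⟨_, (h.hasFDerivAt hz).differentiableAt.hasFDerivAt, ?_⟩
    set D := fderiv ℝ (fun z => F (proj L z)) z
    have hρ := sum_norm_sq_pos (h.frame.exists_ne_zero z hz)
    set r := √(∑ i, ‖k i z‖ ^ 2) with hr
    have hr0 : 0 < r := Real.sqrt_pos.mpr hρ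
    have hn : ∀ v, ‖D v‖ = ‖v‖ * r := fun v => by
      rw [← Real.sqrt_sq (norm_nonneg (D v)), h.norm_fderiv_apply_sq hz v,
        Real.sqrt_mul (by positivity), Real.sqrt_sq (norm_nonneg v)]
    refine ⟨r, hr0.ne', ⟨(r⁻¹ • D : ℂ →L[ℝ] R4).toLinearMap, fun v => ?_⟩, ?_⟩
    · have : ‖r⁻¹ • D v‖ = ‖v‖ := by
        rw [norm_smul, hn, norm_inv, Real.norm_of_nonneg hr0.le]; field_simp
      simpa using this
    · ext1 v
      simp [smul_smul, hr0.ne']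

theorem gaussCurvature_mul_conformalFactor {z : ℂ} (hz : z ∉ L.lattice) :
    gaussCurvature (fun z => F (proj L z)) z * conformalFactor (fun z => F (proj L z)) z =
      -(1 / 2) * (Δ (fun w => Real.log (∑ i, ‖k i w‖ ^ 2))) z := by
  have h1 : (fun w => Real.log (conformalFactor (fun z => F (proj L z)) w)) =ᶠ[𝓝 z]
      fun w => Real.log (∑ i, ‖k i w‖ ^ 2) := by
    filter_upwards [L.isOpen_compl_lattice.mem_nhds hz] with w hw
    rw [h.conformalFactor_eq hw]
  have h2 := (sum_norm_sq_pos (h.frame.exists_ne_zero z hz)).ne'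
  rw [gaussCurvature, (InnerProductSpace.laplacian_congr_nhds h1).eq_of_nhds,
    h.conformalFactor_eq hz]
  field_simp

theorem continuousAt {p : Torus L} (hp : p ≠ 0) : ContinuousAt F p := by
  obtain ⟨z, rfl⟩ := (isOpenQuotientMap_proj L).surjective p
  rw [← (isOpenQuotientMap_proj L).continuousAt_comp_iff]
  exact (h.hasFDerivAt fun hz => hp (proj_eq_zero.mpr hz)).continuousAt

/-- The first primitive grows like `|c| |z|⁻³` while the second is `o(|z|⁻³)`, so they cannot cancel
in `e + conj f`. -/
theorem tendsto_norm : Tendsto (fun z => ‖F (proj L z)‖) (𝓝[≠] 0) atTop := by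
  have h0 := (h.tendsto 0).norm
  have h1 := (h.tendsto 1).norm
  simp only [if_pos, norm_mul, norm_pow] at h0
  simp only [one_ne_zero, if_false, norm_mul, norm_pow, norm_zero] at h1
  have h2 := h0.sub h1
  rw [sub_zero] at h2
  have h3 : Tendsto (fun z : ℂ => (‖z‖ ^ 3)⁻¹) (𝓝[≠] 0) atTop := by
    refine tendsto_inv_nhdsGT_zero.comp (tendsto_nhdsWithin_iff.mpr ⟨?_, ?_⟩)
    · have : Tendsto (fun z : ℂ => ‖z‖ ^ 3) (𝓝 0) (𝓝 (‖(0 : ℂ)‖ ^ 3)) :=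
        Continuous.tendsto (by fun_prop) 0
      simpa using this.mono_left nhdsWithin_le_nhds
    · filter_upwards [self_mem_nhdsWithin] with z (hz : z ≠ 0)
      have : 0 < ‖z‖ := norm_pos_iff.mpr hz
      exact Set.mem_Ioi.mpr (by positivity)
  refine tendsto_atTop_mono' _ ?_ (h3.atTop_mul_pos (norm_pos_iff.mpr h.ne_zero) h2)
  filter_upwards [self_mem_nhdsWithin, mem_nhdsWithin_of_mem_nhds
      (L.compl_lattice_sdiff_singleton_mem_nhds 0)] with z (hz : z ≠ 0) hz'
  have hzL : z ∉ L.lattice := by simp_all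
  rw [h.eq_assemble z hzL]
  refine le_trans (le_of_eq ?_) (norm_ge_of_assemble _)
  have : ‖z‖ ≠ 0 := norm_ne_zero_iff.mpr hz
  field_simp

theorem continuousOn_compl_image_ball {ε : ℝ} (hε : 0 < ε) :
    ContinuousOn F (proj L '' Metric.ball 0 ε)ᶜ := fun p hp =>
  (h.continuousAt (by
    rintro rfl
    exact hp ⟨0, Metric.mem_ball_self hε, proj_eq_zero.mpr (zero_mem _)⟩)).continuousWithinAt

/-- Since `‖F‖` tends to infinity at the puncture, the preimage of a compact set avoids a
neighbourhood of `0` and is closed in the compact torus. -/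
theorem isProperMap : IsProperMap (({0}ᶜ : Set (Torus L)).domRestrict F) := by
  have := compactSpace_torus L
  rw [isProperMap_iff_isCompact_preimage]
  refine ⟨ContinuousOn.domRestrict fun p hp => (h.continuousAt hp).continuousWithinAt,
    fun K hK => ?_⟩
  obtain ⟨M, hM⟩ := hK.isBounded.exists_norm_le
  have h1 := h.tendsto_norm.eventually (eventually_gt_atTop M)
  rw [eventually_nhdsWithin_iff, Metric.eventually_nhds_iff_ball] at h1
  obtain ⟨ε, hε, hball⟩ := h1
  rw [Subtype.isCompact_iff]
  have e : Subtype.val '' (({0}ᶜ : Set (Torus L)).domRestrict F ⁻¹' K) =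
      (proj L '' Metric.ball 0 ε)ᶜ ∩ F ⁻¹' K := by
    ext p
    constructor
    · rintro ⟨⟨q, hq⟩, hqK, rfl⟩
      refine ⟨?_, hqK⟩
      rintro ⟨z, hz, rfl⟩
      have hz0 : z ≠ 0 := fun hz0 => hq (by rw [hz0]; exact proj_eq_zero.mpr (zero_mem _))
      exact (hball z hz hz0).not_ge (hM _ hqK)
    · rintro ⟨hp, hpK⟩
      refine ⟨⟨p, ?_⟩, hpK, rfl⟩
      rintro rfl
      exact hp ⟨0, Metric.mem_ball_self hε, proj_eq_zero.mpr (zero_mem _)⟩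
  rw [e]
  exact ((h.continuousOn_compl_image_ball hε).preimage_isClosed_of_isClosed
    (isClosed_compl_image_ball L _) hK.isClosed).isCompact

theorem hasSingleEnd : HasSingleEnd L F := by
  have := compactSpace_torus L
  -- With `κ³ = c`, the substitution `z = κ / w` turns the leading term `c z⁻³` into exactly `w³`.
  obtain ⟨κ, hκ⟩ := IsAlgClosed.exists_pow_nat_eq c (n := 3) (by norm_num)
  have hκ0 : κ ≠ 0 := by rintro rfl; exact h.ne_zero (by rw [← hκ]; simp)
  obtain ⟨δ, hδ, hball⟩ := Metric.mem_nhds_iff.mp (L.compl_lattice_sdiff_singleton_mem_nhds 0)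
  have hδ0 : ∀ z ∈ L.lattice, ‖z‖ < δ → z = 0 := fun z hz hzδ => by
    by_contra hz0
    exact hball (by simpa using hzδ) ⟨hz, hz0⟩
  -- Half the radius, so that the difference of two points of the disc is still too short to be a
  -- nonzero lattice vector; this gives injectivity modulo the lattice.
  set ε := δ / 2 with hε
  have hε0 : 0 < ε := by positivity
  -- `F` is bounded by `r` off the disc around the puncture, so every point with larger image lies
  -- in the end.
  obtain ⟨r, hr⟩ := ((isClosed_compl_image_ball L _).isCompact.image_of_continuousOn
    (h.continuousOn_compl_image_ball hε0)).isBounded.exists_norm_le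
  have hR : 0 < ‖κ‖ / ε := div_pos (norm_pos_iff.mpr hκ0) hε0
  have hne : ∀ w ∈ {z : ℂ | ‖κ‖ / ε < ‖z‖}, w ≠ 0 := fun w hw =>
    norm_pos_iff.mp (hR.trans hw)
  have hsmall : ∀ w ∈ {z : ℂ | ‖κ‖ / ε < ‖z‖}, ‖κ / w‖ < ε := fun w hw => by
    rw [norm_div, div_lt_comm₀ (norm_pos_iff.mpr (hne w hw)) hε0]
    exact hw
  have hφ : Tendsto (fun w => κ / w) (Bornology.cobounded ℂ) (𝓝[≠] 0) := by
    refine tendsto_nhdsWithin_iff.mpr ⟨?_, ?_⟩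
    · simpa [div_eq_mul_inv] using tendsto_inv₀_cobounded.const_mul κ
    · filter_upwards [Bornology.eventually_ne_cobounded 0] with w hw
      exact div_ne_zero hκ0 hw
  refine ⟨3, ‖κ‖ / ε, r, fun w => κ / w, LinearIsometryEquiv.refl ℝ R4, by norm_num, hR,
    fun w hw => ?_, fun w hw hL => ?_, fun w hw w' hw' hww => ?_, fun p hp hrp => ?_, ?_⟩
  · exact ((differentiableAt_const κ).div differentiableAt_id (hne w hw)).differentiableWithinAt
  · exact div_ne_zero hκ0 (hne w hw) (hδ0 _ hL ((hsmall w hw).trans (by linarith)))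
  · have h1 := hδ0 _ (proj_eq_proj.mp hww) (by
      have := norm_sub_le (κ / w) (κ / w')
      have := hsmall w hw
      have := hsmall w' hw'
      linarith)
    rw [sub_eq_zero, div_eq_div_iff (hne w hw) (hne w' hw')] at h1
    exact (mul_left_cancel₀ hκ0 h1).symm
  · have h1 : p ∈ proj L '' Metric.ball 0 ε := by
      by_contra hp'
      exact hrp.not_ge (hr _ ⟨p, hp', rfl⟩)
    obtain ⟨z, hz, rfl⟩ := h1
    have hz0 : z ≠ 0 := by rintro rfl; exact hp (proj_eq_zero.mpr (zero_mem _))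
    refine ⟨κ / z, ?_, congrArg (proj L) (div_div_cancel₀ hκ0)⟩
    rw [norm_div, div_lt_div_iff_of_pos_left (norm_pos_iff.mpr hκ0) hε0 (norm_pos_iff.mpr hz0)]
    simpa using hz
  · have h1 : ∀ i, (fun w => E i (κ / w) - if i = 0 then w ^ 3 else 0)
        =o[Bornology.cobounded ℂ] fun w => w ^ 3 := by
      intro i
      have h2 : Tendsto (fun w => c⁻¹ * ((κ / w) ^ 3 * E i (κ / w)) - if i = 0 then 1 else 0)
          (Bornology.cobounded ℂ) (𝓝 0) := by
        have h3 := (((h.tendsto i).comp hφ).const_mul c⁻¹).sub_const (if i = 0 then 1 else 0)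
        split_ifs at h3 with hi
        · simpa [hi, h.ne_zero] using h3
        · simpa [hi] using h3
      have h4 := (Asymptotics.isBigO_refl (fun w : ℂ => w ^ 3)
        (Bornology.cobounded ℂ)).mul_isLittleO ((Asymptotics.isLittleO_one_iff ℂ).mpr h2)
      simp only [mul_one] at h4
      refine h4.congr' ?_ .rfl
      filter_upwards [Bornology.eventually_ne_cobounded 0] with w hw
      have hc := h.ne_zero
      rw [div_pow, hκ]
      split_ifs
      · field_simp
      · field_simp
        ring
    have h2 := (assemble.isBigO_comp _ _).trans_isLittleO (Asymptotics.isLittleO_pi.mpr h1)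
    refine h2.congr' ?_ .rfl
    filter_upwards [hφ.eventually (mem_nhdsWithin_of_mem_nhds
      (L.compl_lattice_sdiff_singleton_mem_nhds 0)), hφ.eventually self_mem_nhdsWithin]
      with w hw hw0
    have hwL : κ / w ∉ L.lattice := by
      intro hL; exact hw ⟨hL, hw0⟩
    have e : ofC2 (w ^ 3) 0 = assemble fun i => if i = 0 then w ^ 3 else 0 := by
      simp [assemble_apply]
    rw [h.eq_assemble _ hwL, e]
    exact map_sub assemble (fun i => E i (κ / w)) fun i => if i = 0 then w ^ 3 else 0

end IsRepresentation

theorem IsRepresentation.isSolution {τ : UpperHalfPlane} {F : Torus (periods τ) → R4}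
    {E k : Fin 4 → ℂ → ℂ} {c : ℂ} (h : IsRepresentation (periods τ) F E k c) :
    IsSolution (periods τ) F where
  minimal := h.isMinimalImmersion
  proper := h.isProperMap
  single_end := h.hasSingleEnd
  curvature := by
    have hm := measurableSet_puncturedCell τ
    have he : Set.EqOn (fun z => gaussCurvature (fun z => F (proj (periods τ) z)) z *
        conformalFactor (fun z => F (proj (periods τ) z)) z)
        (fun z => -(1 / 2) * (Δ (fun w => Real.log (∑ i, ‖k i w‖ ^ 2))) z)
        (puncturedCell (periods τ)) := fun z hz =>
      h.gaussCurvature_mul_conformalFactor (notMem_lattice_of_mem_puncturedCell τ hz)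
    obtain ⟨h1, h2⟩ := integral_laplacian_log h.frame
    refine ⟨(integrableOn_congr_fun he hm).mpr (h1.const_mul _), ?_⟩
    rw [setIntegral_congr_fun hm he, integral_const_mul, h2]
    push_cast; ring

end MinimalTorus

/-! ### Algebraic consequences of the system. -/

namespace MinimalTorus

open Filter Topology

/-- If `a = 0` then `tw = 0`, and isotropy at `P = -s`, where `f'` vanishes, forces one of the
constants `v - us`, `x - ys` to vanish. In the first case `c = -uy` and `d = -ux`, and the period
equations give `-|u|² = 1`; in the second `d = -vy` and `-|y|² = 1`. Here `r` plays the role of `Im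
τ / π`. -/
theorem leading_coeff_ne_zero {a b c d s t u v w y x g₂ g₃ η : ℂ} {r : ℝ}
    (h1 : a + 4 * t * w = 0) (h2 : b + t * y + u * w = 0) (h3 : c + a * s + u * y = 0)
    (h4 : d + c * s + u * x + v * y - g₂ * t * w = 0) (h5 : b * s + v * w + t * x = 0)
    (h6 : d * s + v * x - g₃ * t * w = 0)
    (h8 : c * (1 - r * η) + r * (a * (g₂ / 12) + d) - 1 = 0)
    (h9 : u + conj y * (r * conj η - 1) - r * conj x = 0)
    (h10 : u * (1 - r * η) + r * v - conj y = 0) : a ≠ 0 := by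
  rintro rfl
  have h9' := congrArg conj h9
  simp at h9'
  have htw : t * w = 0 := by linear_combination h1 / 4
  have hmain : v - u * s = 0 ∨ x - y * s = 0 := by
    rcases mul_eq_zero.mp htw with rfl | rfl
    · by_cases hw : w = 0
      · subst hw
        refine mul_eq_zero.mp ?_
        -- With `t = w = 0` this combination is `(v - us)(x - ys) = 0`.
        linear_combination h6 - s * h4 + s ^ 2 * h3
      · left
        refine mul_left_cancel₀ hw ?_
        linear_combination h5 - s * h2
    · by_cases ht : t = 0
      · subst ht
        refine mul_eq_zero.mp ?_
        linear_combination h6 - s * h4 + s ^ 2 * h3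
      · right
        refine mul_left_cancel₀ ht ?_
        linear_combination h5 - s * h2
  have key : ∀ q : ℂ, q * conj q + 1 ≠ 0 := fun q hq => by
    rw [Complex.mul_conj] at hq
    have h : (Complex.normSq q : ℝ) + 1 = 0 := by exact_mod_cast hq
    linarith [Complex.normSq_nonneg q]
  rcases hmain with h | h
  · refine key u ?_
    linear_combination -h8 + (1 - r * η) * h3 + r * h4 - r * s * h3 - r * y * h + u * h9' +
      r * g₂ * htw
  · refine key y ?_
    linear_combination -h8 + (1 - r * η) * h3 + r * h4 - r * s * h3 - r * u * h - y * h10 +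
      r * g₂ * htw

/-- The polynomial `e'f' + g'h'` is `tw` times the equation of the cubic, and `tw = -a/4 ≠ 0`. At a
common zero of the four factors its gradient vanishes, so the cubic would be singular there. -/
theorem no_common_zero {a b c d s t u v w y x g₂ g₃ P Q : ℂ} (ha : a ≠ 0)
    (h1 : a + 4 * t * w = 0) (h2 : b + t * y + u * w = 0) (h3 : c + a * s + u * y = 0)
    (h4 : d + c * s + u * x + v * y - g₂ * t * w = 0) (h5 : b * s + v * w + t * x = 0)
    (h6 : d * s + v * x - g₃ * t * w = 0)
    (hPQ : Q ^ 2 = 4 * P ^ 3 - g₂ * P - g₃) (hQ : Q = 0 → 12 * P ^ 2 ≠ g₂)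
    (e0 : a * P ^ 2 + b * Q + c * P + d = 0) (e1 : P + s = 0) (e2 : t * Q + u * P + v = 0)
    (e3 : w * Q + y * P + x = 0) : False := by
  have htw : t * w ≠ 0 := fun h => ha (by linear_combination h1 - 4 * h)
  have hs : s = -P := by linear_combination e1
  subst hs
  -- Isotropy evaluated at the conjugate point `(P, -Q)` of the cubic: `f'` still vanishes, while
  -- `g'` and `h'` become `-2tQ` and `-2wQ`.
  have h7 : (t * w) * Q ^ 2 = 0 := by
    have hv : v = -t * Q - u * P := by linear_combination e2
    have hx : x = -w * Q - y * P := by linear_combination e3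
    subst hv hx
    linear_combination (h6 + P * h4 + P ^ 2 * h3 + P ^ 3 * h1 + (t * w) * hPQ -
      Q * (h5 + P * h2)) / 4
  have hQ0 : Q = 0 := by
    rcases mul_eq_zero.mp h7 with h | h
    · exact absurd h htw
    · exact pow_eq_zero_iff two_ne_zero |>.mp h
  subst hQ0
  refine hQ rfl (mul_left_cancel₀ htw ?_)
  -- The `P`-derivative of the polynomial identity at `Q = 0`.
  linear_combination -e0 + h4 + 2 * P * h3 + 3 * P ^ 2 * h1 - u * e3 - y * e2

theorem isotropic {a b c d s t u v w y x g₂ g₃ P Q : ℂ}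
    (h1 : a + 4 * t * w = 0) (h2 : b + t * y + u * w = 0) (h3 : c + a * s + u * y = 0)
    (h4 : d + c * s + u * x + v * y - g₂ * t * w = 0) (h5 : b * s + v * w + t * x = 0)
    (h6 : d * s + v * x - g₃ * t * w = 0) (hPQ : Q ^ 2 = 4 * P ^ 3 - g₂ * P - g₃) :
    (a * P ^ 2 + b * Q + c * P + d) * (P + s) + (t * Q + u * P + v) * (w * Q + y * P + x) = 0 := by
  linear_combination P ^ 3 * h1 + P * Q * h2 + P ^ 2 * h3 + P * h4 + Q * h5 + h6 + t * w * hPQ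

/-! ### The period conditions. -/

variable (τ : UpperHalfPlane)

/-- The period conditions for `z ↦ -α ζ(z) + β z + conj (-γ ζ(z) + δ z)`. -/
theorem period_eq_zero {α β γ δ : ℂ}
    (hA : α - conj γ + ((τ.im / π : ℝ) : ℂ) * (conj γ * conj (eta₁ τ) - conj δ) = 0)
    (hB : α - conj γ + ((τ.im / π : ℝ) : ℂ) * (β - α * eta₁ τ) = 0) {l : ℂ}
    (hl : l ∈ (periods τ).lattice) :
    -α * (periods τ).quasiPeriod l + β * l +
      conj (-γ * (periods τ).quasiPeriod l + δ * l) = 0 := by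
  have hπ : (π : ℂ) ≠ 0 := by exact_mod_cast Real.pi_ne_zero
  have hk : ((τ.im / π : ℝ) : ℂ) ≠ 0 := by
    exact_mod_cast (div_pos τ.im_pos Real.pi_pos).ne'
  -- The difference of the two conditions is the vanishing of the period along `1`; the period along
  -- `τ` then follows from Legendre and `τ - conj τ = 2i Im τ`.
  have h1 : β - α * eta₁ τ = conj γ * conj (eta₁ τ) - conj δ := by
    refine mul_left_cancel₀ hk ?_
    linear_combination hB - hA
  have hl2 := legendre τ
  have hη : (periods τ).quasiPeriod τ = τ * eta₁ τ - 2 * π * Complex.I := by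
    linear_combination -hl2
  have hτ : (τ : ℂ) - conj (τ : ℂ) = 2 * Complex.I * π * ((τ.im / π : ℝ) : ℂ) := by
    rw [Complex.sub_conj]
    push_cast
    field_simp
    simp
  -- The period is additive in `l`, so it suffices to check the generators `1` and `τ`.
  let f : (periods τ).lattice →+ ℂ := AddMonoidHom.mk'
    (fun l => -α * (periods τ).quasiPeriod l + β * l +
      conj (-γ * (periods τ).quasiPeriod l + δ * l)) fun l m => by
        simp only [Submodule.coe_add, (periods τ).quasiPeriod_add l.2 m.2, map_add, map_mul, map_neg]
        ring
  have f1 : f ⟨1, one_mem_lattice τ⟩ = 0 := by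
    simp only [f, AddMonoidHom.mk'_apply, ← eta₁_eq_quasiPeriod, map_add, map_mul, map_neg, map_one]
    linear_combination h1
  have f2 : f ⟨τ, tau_mem_lattice τ⟩ = 0 := by
    simp only [f, AddMonoidHom.mk'_apply, hη, map_add, map_mul, map_neg, map_sub,
      Complex.conj_I, Complex.conj_ofReal, map_ofNat]
    linear_combination 2 * π * Complex.I * hB + (β - α * eta₁ τ) * hτ + conj (τ : ℂ) * h1
  obtain ⟨m, n, rfl⟩ := PeriodPair.mem_lattice.mp hl
  have e : (⟨_, hl⟩ : (periods τ).lattice) =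
      m • ⟨1, one_mem_lattice τ⟩ + n • ⟨τ, tau_mem_lattice τ⟩ := by
    refine Subtype.ext ?_
    rw [Submodule.coe_add, Submodule.coe_smul, Submodule.coe_smul]
    simp [periods]
  have f3 : f ⟨_, hl⟩ = 0 := by
    rw [e, map_add, map_zsmul, map_zsmul, f1, f2]; simp
  exact f3

/-! ### The explicit frame, its primitives and their behaviour at the puncture. -/

section Data

variable (L : PeriodPair) (a b c d s t u v w y x : ℂ)

/-- The components `e', f', g', h'` of the frame. -/
noncomputable def frame : Fin 4 → ℂ → ℂ :=
  ![fun z => a * L.weierstrassP z ^ 2 + b * L.derivWeierstrassP z + c * L.weierstrassP z + d,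
    fun z => L.weierstrassP z + s,
    fun z => t * L.derivWeierstrassP z + u * L.weierstrassP z + v,
    fun z => w * L.derivWeierstrassP z + y * L.weierstrassP z + x]

/-- The primitives `e, f, g, h` of the frame. -/
noncomputable def primitives : Fin 4 → ℂ → ℂ :=
  ![fun z => a / 6 * L.derivWeierstrassP z + b * L.weierstrassP z +
      (-c * L.weierstrassZeta z + (a * (L.g₂ / 12) + d) * z),
    fun z => -1 * L.weierstrassZeta z + s * z,
    fun z => t * L.weierstrassP z + (-u * L.weierstrassZeta z + v * z),
    fun z => w * L.weierstrassP z + (-y * L.weierstrassZeta z + x * z)]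

theorem hasDerivAt_primitives (i : Fin 4) {z : ℂ} (hz : z ∉ L.lattice) :
    HasDerivAt (primitives L a b c d s t u v w y x i) (frame L a b c d s t u v w y x i z) z := by
  have hP := L.hasDerivAt_weierstrassP hz
  have hQ := L.hasDerivAt_derivWeierstrassP hz
  have hZ := L.hasDerivAt_weierstrassZeta hz
  have hi := hasDerivAt_id' z
  fin_cases i
  -- Integrates `a℘²` through `℘² = ℘''/6 + g₂/12`; this is the source of the constant `a g₂ / 12`
  -- in the second period equation.
  · exact (((hQ.const_mul (a / 6)).add (hP.const_mul b)).add
      ((hZ.const_mul (-c)).add (hi.const_mul _))).congr_deriv (by simp [frame]; ring)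
  · exact ((hZ.const_mul (-1)).add (hi.const_mul s)).congr_deriv (by simp [frame])
  · exact ((hP.const_mul t).add ((hZ.const_mul (-u)).add (hi.const_mul v))).congr_deriv
      (by simp [frame]; ring)
  · exact ((hP.const_mul w).add ((hZ.const_mul (-y)).add (hi.const_mul x))).congr_deriv
      (by simp [frame]; ring)

theorem meromorphic_primitives (i : Fin 4) :
    Meromorphic (primitives L a b c d s t u v w y x i) := by
  intro z
  have hP := L.meromorphic_weierstrassP z
  have hQ := L.meromorphic_derivWeierstrassP z
  have hZ := L.meromorphic_weierstrassZeta z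
  fin_cases i <;> simp only [primitives] <;> simp <;> fun_prop

theorem analyticOnNhd_frame (i : Fin 4) :
    AnalyticOnNhd ℂ (frame L a b c d s t u v w y x i) (L.lattice : Set ℂ)ᶜ := by
  intro z hz
  have hP := L.analyticOnNhd_weierstrassP z hz
  have hQ := L.analyticOnNhd_derivWeierstrassP z hz
  fin_cases i <;> simp only [frame] <;> simp <;> fun_prop

theorem frame_add (i : Fin 4) {l : ℂ} (hl : l ∈ L.lattice) (z : ℂ) :
    frame L a b c d s t u v w y x i (z + l) = frame L a b c d s t u v w y x i z := by
  have hP := L.weierstrassP_add_coe z ⟨l, hl⟩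
  have hQ := L.derivWeierstrassP_add_coe z ⟨l, hl⟩
  simp only at hP hQ
  fin_cases i <;> simp [frame, hP, hQ]

/-- The frame multiplied by `z ^ 4`, regular at the origin. -/
noncomputable def regularFrame : Fin 4 → ℂ → ℂ :=
  ![fun z => a * (L.weierstrassPExcept 0 z * z ^ 2 + 1) ^ 2 +
      b * z * (L.derivWeierstrassPExcept 0 z * z ^ 3 - 2) +
      c * z ^ 2 * (L.weierstrassPExcept 0 z * z ^ 2 + 1) + d * z ^ 4,
    fun z => z * (z * (L.weierstrassPExcept 0 z * z ^ 2 + 1) + s * z ^ 3),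
    fun z => z * (t * (L.derivWeierstrassPExcept 0 z * z ^ 3 - 2) +
      u * z * (L.weierstrassPExcept 0 z * z ^ 2 + 1) + v * z ^ 3),
    fun z => z * (w * (L.derivWeierstrassPExcept 0 z * z ^ 3 - 2) +
      y * z * (L.weierstrassPExcept 0 z * z ^ 2 + 1) + x * z ^ 3)]

theorem analyticAt_regularFrame (i : Fin 4) :
    AnalyticAt ℂ (regularFrame L a b c d s t u v w y x i) 0 := by
  have hP := L.analyticAt_weierstrassPExcept 0
  have hQ := L.analyticAt_derivWeierstrassPExcept 0
  fin_cases i <;> simp only [regularFrame] <;> simp <;> fun_prop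

theorem regularFrame_eq (i : Fin 4) {z : ℂ} (hz : z ∉ L.lattice) :
    regularFrame L a b c d s t u v w y x i z = frame L a b c d s t u v w y x i z * z ^ 4 := by
  have h0 := L.zero_notMem_of_notMem hz
  fin_cases i <;>
    simp [regularFrame, frame, L.weierstrassPExcept_zero_eq z,
      L.derivWeierstrassPExcept_zero_eq z] <;> field_simp

theorem eventually_notMem_lattice : ∀ᶠ z in 𝓝[≠] 0, z ∉ L.lattice := by
  filter_upwards [self_mem_nhdsWithin, mem_nhdsWithin_of_mem_nhds
    (L.compl_lattice_sdiff_singleton_mem_nhds 0)] with z hz hz'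
  intro h
  exact hz' ⟨h, hz⟩

theorem tendsto_primitives (i : Fin 4) :
    Tendsto (fun z => z ^ 3 * primitives L a b c d s t u v w y x i z) (𝓝[≠] 0)
      (𝓝 (if i = 0 then -a / 3 else 0)) := by
  have hP := (L.analyticAt_weierstrassPExcept 0).continuousAt
  have hQ := (L.analyticAt_derivWeierstrassPExcept 0).continuousAt
  have hZ := L.analyticAt_zetaRegular.continuousAt
  have key : ∀ {f g : ℂ → ℂ} {l : ℂ}, ContinuousAt g 0 → g 0 = l →
      (∀ z ∉ L.lattice, g z = f z) → Tendsto f (𝓝[≠] 0) (𝓝 l) := fun hg h0 he => by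
    rw [← h0]
    refine (hg.tendsto.mono_left nhdsWithin_le_nhds).congr' ?_
    filter_upwards [eventually_notMem_lattice L] with z hz using he z hz
  have hreg : ∀ α β γ : ℂ, Tendsto (fun z => z ^ 3 *
      (α * L.weierstrassP z + (β * L.weierstrassZeta z + γ * z))) (𝓝[≠] 0) (𝓝 0) := by
    intro α β γ
    refine key (g := fun z => α * (L.weierstrassPExcept 0 z * z ^ 3 + z) +
      (β * (z ^ 2 + L.zetaRegular z * z ^ 3) + γ * z ^ 4)) (by fun_prop) (by simp) fun z hz => ?_
    have h0 := L.zero_notMem_of_notMem hz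
    rw [L.weierstrassPExcept_zero_eq, PeriodPair.weierstrassZeta]
    field_simp
  fin_cases i
  -- Only `℘' ~ -2/z³` contributes to order `z⁻³`, with coefficient `(a/6)(-2) = -a/3`.
  · have h1 : Tendsto (fun z => z ^ 3 * (a / 6 * L.derivWeierstrassP z)) (𝓝[≠] 0)
        (𝓝 (-a / 3)) := by
      refine key (g := fun z => a / 6 * (L.derivWeierstrassPExcept 0 z * z ^ 3 - 2))
        (by fun_prop) (by simp; ring) fun z hz => ?_
      have h0 := L.zero_notMem_of_notMem hz
      rw [L.derivWeierstrassPExcept_zero_eq]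
      field_simp
    have h2 := h1.add (hreg b (-c) (a * (L.g₂ / 12) + d))
    rw [add_zero] at h2
    refine h2.congr fun z => ?_
    simp [primitives]; ring
  · exact (hreg 0 (-1) s).congr fun z => by simp [primitives]
  · exact (hreg t (-u) v).congr fun z => by simp [primitives]
  · exact (hreg w (-y) x).congr fun z => by simp [primitives]

theorem deriv_primitives (i : Fin 4) {z : ℂ} (hz : z ∉ L.lattice) :
    deriv (primitives L a b c d s t u v w y x i) z = frame L a b c d s t u v w y x i z :=
  (hasDerivAt_primitives L a b c d s t u v w y x i hz).deriv

theorem isElliptic_deriv_primitives (i : Fin 4) :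
    IsElliptic L (deriv (primitives L a b c d s t u v w y x i)) where
  meromorphic := (meromorphic_primitives L a b c d s t u v w y x i).deriv
  holomorphic := (analyticOnNhd_frame L a b c d s t u v w y x i).differentiableOn.congr
    fun z hz => deriv_primitives L a b c d s t u v w y x i hz
  periodic l hl z hz := by
    rw [deriv_primitives _ _ _ _ _ _ _ _ _ _ _ _ _ hz, deriv_primitives _ _ _ _ _ _ _ _ _ _ _ _ _
      (PeriodPair.add_notMem_lattice hz hl), frame_add _ _ _ _ _ _ _ _ _ _ _ _ _ hl]

theorem meromorphicOrderAt_ge {f G : ℂ → ℂ} {n : ℤ} (hG : AnalyticAt ℂ G 0)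
    (h : ∀ᶠ z in 𝓝[≠] 0, f z = z ^ n * G z) : (n : WithTop ℤ) ≤ meromorphicOrderAt f 0 := by
  have h1 : MeromorphicAt (fun z : ℂ => z ^ n) 0 := by fun_prop
  rw [meromorphicOrderAt_congr (f₂ := (fun z : ℂ => z ^ n) * G) h,
    meromorphicOrderAt_mul h1 hG.meromorphicAt]
  have h2 : meromorphicOrderAt (fun z : ℂ => z ^ n) 0 = n := by
    rw [meromorphicOrderAt_eq_int_iff h1]
    exact ⟨fun _ => 1, analyticAt_const, one_ne_zero, .of_forall fun z => by simp⟩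
  rw [h2]
  exact le_add_of_nonneg_right hG.meromorphicOrderAt_nonneg

theorem meromorphicOrderAt_deriv_primitives_zero (ha : a ≠ 0) :
    meromorphicOrderAt (deriv (primitives L a b c d s t u v w y x 0)) 0 =
      ((-4 : ℤ) : WithTop ℤ) := by
  rw [meromorphicOrderAt_eq_int_iff ((meromorphic_primitives L a b c d s t u v w y x 0).deriv 0)]
  refine ⟨_, analyticAt_regularFrame L a b c d s t u v w y x 0, by simpa [regularFrame] using ha, ?_⟩
  filter_upwards [eventually_notMem_lattice L] with z hz
  have h0 := L.zero_notMem_of_notMem hz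
  rw [deriv_primitives L a b c d s t u v w y x 0 hz, regularFrame_eq L a b c d s t u v w y x 0 hz,
    sub_zero, smul_eq_mul, zpow_neg]
  norm_cast
  field_simp

theorem meromorphicOrderAt_deriv_primitives_ge {i : Fin 4} (hi : i = 2 ∨ i = 3) :
    ((-3 : ℤ) : WithTop ℤ) ≤
      meromorphicOrderAt (deriv (primitives L a b c d s t u v w y x i)) 0 := by
  have hP := L.analyticAt_weierstrassPExcept 0
  have hQ := L.analyticAt_derivWeierstrassPExcept 0
  have key : ∀ α β γ : ℂ, AnalyticAt ℂ (fun z =>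
      α * (L.derivWeierstrassPExcept 0 z * z ^ 3 - 2) +
        β * z * (L.weierstrassPExcept 0 z * z ^ 2 + 1) + γ * z ^ 3) 0 := fun α β γ => by fun_prop
  rcases hi with rfl | rfl
  · refine meromorphicOrderAt_ge (key t u v) ?_
    filter_upwards [eventually_notMem_lattice L] with z hz
    have h0 := L.zero_notMem_of_notMem hz
    rw [deriv_primitives L a b c d s t u v w y x 2 hz, zpow_neg]
    norm_cast
    simp [frame, L.weierstrassPExcept_zero_eq z, L.derivWeierstrassPExcept_zero_eq z]
    field_simp
  · refine meromorphicOrderAt_ge (key w y x) ?_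
    filter_upwards [eventually_notMem_lattice L] with z hz
    have h0 := L.zero_notMem_of_notMem hz
    rw [deriv_primitives L a b c d s t u v w y x 3 hz, zpow_neg]
    norm_cast
    simp [frame, L.weierstrassPExcept_zero_eq z, L.derivWeierstrassPExcept_zero_eq z]
    field_simp

end Data

/-- The `℘` and `℘'` terms are periodic, so only the linear combinations of `ζ` and `z` contribute,
and their periods cancel within each pair `e + conj f`, `g + conj h`. -/
theorem primitives_add {a b c d s t u v w y x : ℂ}
    (h7 : c - 1 + ((τ.im / π : ℝ) : ℂ) * (conj (eta₁ τ) - conj s) = 0)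
    (h8 : c * (1 - ((τ.im / π : ℝ) : ℂ) * eta₁ τ) +
      ((τ.im / π : ℝ) : ℂ) * (a * ((periods τ).g₂ / 12) + d) - 1 = 0)
    (h9 : u + conj y * (((τ.im / π : ℝ) : ℂ) * conj (eta₁ τ) - 1) -
      ((τ.im / π : ℝ) : ℂ) * conj x = 0)
    (h10 : u * (1 - ((τ.im / π : ℝ) : ℂ) * eta₁ τ) + ((τ.im / π : ℝ) : ℂ) * v - conj y = 0)
    {l z : ℂ} (hl : l ∈ (periods τ).lattice) (hz : z ∉ (periods τ).lattice) :
    (assemble fun i => primitives (periods τ) a b c d s t u v w y x i (z + l)) =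
      assemble fun i => primitives (periods τ) a b c d s t u v w y x i z := by
  set L := periods τ
  have k1 := period_eq_zero τ (α := c) (β := a * (L.g₂ / 12) + d) (γ := 1) (δ := s)
    (by simp only [map_one]; linear_combination h7) (by simp only [map_one]; linear_combination h8) hl
  have k2 := period_eq_zero τ (α := u) (β := v) (γ := y) (δ := x)
    (by linear_combination h9) (by linear_combination h10) hl
  have hP := L.weierstrassP_add_coe z ⟨l, hl⟩
  have hQ := L.derivWeierstrassP_add_coe z ⟨l, hl⟩
  have hZ := L.weierstrassZeta_add hl hz
  simp only at hP hQ
  rw [assemble_apply, assemble_apply]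
  simp only [map_add, map_mul, map_neg, map_one] at k1 k2
  congr 1
  · simp [primitives, hP, hQ, hZ]
    linear_combination k1
  · simp [primitives, hP, hZ]
    linear_combination k2

end MinimalTorus

/-! ### Assembling the solution. -/

theorem mainTheorem6 (τ : UpperHalfPlane)
    (hsys : ∃ a b c d s t u v w y z : ℂ,
      (a + 4 * t * w = 0 ∧
        b + t * y + u * w = 0 ∧
        c + a * s + u * y = 0 ∧
        d + c * s + u * z + v * y - (MinimalTorus.periods τ).g₂ * t * w = 0 ∧
        b * s + v * w + t * z = 0 ∧
        d * s + v * z - (MinimalTorus.periods τ).g₃ * t * w = 0) ∧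
      (c - 1 + ((τ.im / π : ℝ) : ℂ) * (conj (MinimalTorus.eta₁ τ) - conj s) = 0 ∧
        c * (1 - ((τ.im / π : ℝ) : ℂ) * MinimalTorus.eta₁ τ) +
          ((τ.im / π : ℝ) : ℂ) * (a * ((MinimalTorus.periods τ).g₂ / 12) + d) - 1 = 0) ∧
      (u + conj y * (((τ.im / π : ℝ) : ℂ) * conj (MinimalTorus.eta₁ τ) - 1) -
          ((τ.im / π : ℝ) : ℂ) * conj z = 0 ∧
        u * (1 - ((τ.im / π : ℝ) : ℂ) * MinimalTorus.eta₁ τ) +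
          ((τ.im / π : ℝ) : ℂ) * v - conj y = 0)) :
    MinimalTorus.AdmitsTypeIISolution (MinimalTorus.periods τ) := by
  obtain ⟨a, b, c, d, s, t, u, v, w, y, x, ⟨h1, h2, h3, h4, h5, h6⟩, ⟨h7, h8⟩, h9, h10⟩ := hsys
  have ha := MinimalTorus.leading_coeff_ne_zero h1 h2 h3 h4 h5 h6 h8 h9 h10
  set L := MinimalTorus.periods τ with hL
  let E := MinimalTorus.primitives L a b c d s t u v w y x
  have hsurj := (MinimalTorus.isOpenQuotientMap_proj L).surjective
  -- An arbitrary set-theoretic lift suffices: off the lattice the assembled primitives do not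
  -- depend on it, and the value at the puncture plays no role.
  let F : MinimalTorus.Torus L → MinimalTorus.R4 := fun p =>
    MinimalTorus.assemble fun i => E i (Function.surjInv hsurj p)
  have hF : ∀ z ∉ L.lattice, F (MinimalTorus.proj L z) = MinimalTorus.assemble fun i => E i z := by
    intro z hz
    have hl := MinimalTorus.proj_eq_proj.mp
      (Function.surjInv_eq hsurj (MinimalTorus.proj L z))
    have := MinimalTorus.primitives_add τ (b := b) (t := t) (w := w) h7 h8 h9 h10 hl hz
    rwa [add_sub_cancel] at this
  have hiso : ∀ z ∉ L.lattice, _ := fun z hz =>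
    MinimalTorus.isotropic h1 h2 h3 h4 h5 h6 (L.derivWeierstrassP_sq z hz)
  have hrep : MinimalTorus.IsRepresentation L F E
      (MinimalTorus.frame L a b c d s t u v w y x) (-a / 3) :=
    { hasDerivAt := fun i z hz => MinimalTorus.hasDerivAt_primitives L a b c d s t u v w y x i hz
      frame :=
        { analytic := MinimalTorus.analyticOnNhd_frame L a b c d s t u v w y x
          periodic := fun i l hl z _ => MinimalTorus.frame_add L a b c d s t u v w y x i hl z
          exists_ne_zero := fun z hz => by
            by_contra! hall
            exact MinimalTorus.no_common_zero ha h1 h2 h3 h4 h5 h6 (L.derivWeierstrassP_sq z hz)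
              (L.twelve_mul_sq_ne_g₂ hz) (hall 0) (hall 1) (hall 2) (hall 3)
          exists_regular := ⟨MinimalTorus.regularFrame L a b c d s t u v w y x,
            MinimalTorus.analyticAt_regularFrame L a b c d s t u v w y x,
            fun i z hz => MinimalTorus.regularFrame_eq L a b c d s t u v w y x i hz,
            0, by simpa [MinimalTorus.regularFrame] using ha⟩ }
      conformal := hiso
      eq_assemble := hF
      ne_zero := div_ne_zero (neg_ne_zero.mpr ha) (by norm_num)
      tendsto := MinimalTorus.tendsto_primitives L a b c d s t u v w y x }
  have hdiff : ∀ i, DifferentiableOn ℂ (E i) (L.lattice : Set ℂ)ᶜ := fun i z hz =>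
    (hrep.hasDerivAt i z hz).differentiableAt.differentiableWithinAt
  have hell := MinimalTorus.isElliptic_deriv_primitives L a b c d s t u v w y x
  refine ⟨F, hrep.isSolution, E 0, E 1, E 2, E 3, s,
    ⟨hdiff 0, hdiff 1, hdiff 2, hdiff 3⟩, hF, ⟨hell 0, hell 1, hell 2, hell 3⟩, fun z hz => ?_,
    MinimalTorus.meromorphicOrderAt_deriv_primitives_zero L a b c d s t u v w y x ha,
    MinimalTorus.meromorphicOrderAt_deriv_primitives_ge L a b c d s t u v w y x (.inl rfl),
    MinimalTorus.meromorphicOrderAt_deriv_primitives_ge L a b c d s t u v w y x (.inr rfl),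
    fun z hz => ?_⟩
  · rw [(hrep.hasDerivAt 0 z hz).deriv, (hrep.hasDerivAt 1 z hz).deriv,
      (hrep.hasDerivAt 2 z hz).deriv, (hrep.hasDerivAt 3 z hz).deriv]
    exact hiso z hz
  · exact (hrep.hasDerivAt 1 z hz).deriv
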